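/- Let $n\ge 0$, let $G$ be a finite group, and let $K$ be a splitting field for $G$ (every simple $KG$-module stays simple after extension of scalars to the algebraic closure of $K$) whose characteristic does not divide $|G|$. Let $\Sigma_n$ be the monoid of ordered set partitions of $\{1,\dots,n\}$ with product $$(P_1,\dots,P_r)(Q_1,\dots,Q_s)=(P_1\cap Q_1,\dots,P_1\cap Q_s,P_2\cap Q_1,\dots,P_r\cap Q_s)^\wedge,$$ where $\wedge$ means that empty intersections are omitted, and let $\sigma(\pi)$ be the set partition underlying $\pi\in\Sigma_n$. Let $\Pi_n$ be the set of set partitions of $\{1,\dots,n\}$, ordered so that $X\le Y$ if and only if $X$ refines $Y$, and let $|X|$ be the number of blocks of $X$. For $X\in\Pi_n$ put $G_X=\{g\in G^n : g_i=g_j \text{ whenever } i,j \text{ lie in the same block of } X\}$, and for $g\in G_X$ and a block $P\in X$ let $g_P$ be the common value of $g$ on $P$. Hsiao's monoid of ordered $G$-partitions is the submonoid $\Sigma_n^G=\{(\pi,g) : g\in G_{\sigma(\pi)}\}$ of $\Sigma_n\times G^n$. For $X\in\Pi_n$ and a function $f$ assigning to each block $P\in X$ a simple $KG$-module $f(P)$,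 let $(X,f)$ denote the left $K\Sigma_n^G$-module with underlying space $\bigotimes_{P\in X}f(P)$ on which $(\pi,g)$ acts by $\bigotimes_{P\in X}v_P\mapsto\bigotimes_{P\in X}g_Pv_P$ if $X\le\sigma(\pi)$, and by $0$ otherwise. (These modules are, up to isomorphism, the simple $K\Sigma_n^G$-modules.) Then for all such $(X,f)$ and $(Y,h)$ and all $q\ge 0$, $\operatorname{Ext}^q_{K\Sigma_n^G}((X,f),(Y,h))=0$ unless $X\le Y$ and $q=|X|-|Y|$, in which case there is an isomorphism of $K$-vector spaces $$\operatorname{Ext}^q_{K\Sigma_n^G}((X,f),(Y,h))\cong\bigotimes_{P\in Y}\operatorname{Hom}_{KG}\Bigl(\bigotimes_{Q\in X,\,Q\subseteq P}f(Q),\,h(P)\Bigr),$$ where $G$ acts diagonally on the inner tensor product. -/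

import Mathlib

open scoped TensorProduct MonoidAlgebra

universe u v w

namespace Hsiao

/-! ### Ordered set partitions -/

/-- An ordered set partition of an `n`-element set: a list `(P₁, …, P_r)` of non-empty, pairwise
disjoint subsets covering the set. -/
@[ext]
structure OrderedSetPartition (n : ℕ) where
  /-- the blocks, in order -/
  blocks : List (Finset (Fin n))
  nonempty : ∀ P ∈ blocks, P.Nonempty
  disjoint : blocks.Pairwise Disjoint
  cover : ∀ i, ∃ P ∈ blocks, i ∈ P

/-- `(P₁, …, P_r), (Q₁, …, Q_s) ↦ (P₁ ∩ Q₁, …, P₁ ∩ Q_s, P₂ ∩ Q₁, …, P_r ∩ Q_s)`, with the empty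
intersections omitted. -/
def mulBlocks {n : ℕ} (L M : List (Finset (Fin n))) : List (Finset (Fin n)) :=
  (L.flatMap fun P => M.map fun Q => P ∩ Q).filter fun P => P.Nonempty

theorem mem_mulBlocks {n : ℕ} {L M : List (Finset (Fin n))} {R : Finset (Fin n)} :
    R ∈ mulBlocks L M ↔ (∃ P ∈ L, ∃ Q ∈ M, P ∩ Q = R) ∧ R.Nonempty := by
  simp [mulBlocks]

theorem mulBlocks_cons {n : ℕ} (P : Finset (Fin n)) (L M : List (Finset (Fin n))) :
    mulBlocks (P :: L) M =
      ((M.map fun Q => P ∩ Q).filter fun R => R.Nonempty) ++ mulBlocks L M := by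
  simp [mulBlocks, List.filter_append]

theorem mulBlocks_append {n : ℕ} (L L' M : List (Finset (Fin n))) :
    mulBlocks (L ++ L') M = mulBlocks L M ++ mulBlocks L' M := by
  simp [mulBlocks, List.filter_append]

theorem mulBlocks_assoc_aux {n : ℕ} (P : Finset (Fin n)) (M N : List (Finset (Fin n))) :
    mulBlocks ((M.map fun Q => P ∩ Q).filter fun R => R.Nonempty) N =
      ((mulBlocks M N).map fun Q => P ∩ Q).filter fun R => R.Nonempty := by
  induction M with
  | nil => simp [mulBlocks]
  | cons Q M ih =>
    have key : (((N.map fun R => Q ∩ R).filter fun S => S.Nonempty).map fun S => P ∩ S).filter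
        (fun S => S.Nonempty) =
        (N.map fun R => (P ∩ Q) ∩ R).filter fun S => S.Nonempty := by
      clear ih
      induction N with
      | nil => simp
      | cons R N ih =>
        simp only [List.map_cons, List.filter_cons, Finset.inter_assoc] at ih ⊢
        by_cases h : (Q ∩ R).Nonempty
        · simp [h, ih, List.filter_cons]
        · have h' : ¬ (P ∩ (Q ∩ R)).Nonempty :=
            fun hh => h (hh.mono Finset.inter_subset_right)
          simp [h, h', ih]
    rw [mulBlocks_cons, List.map_append, List.filter_append, key, ← ih, List.map_cons,
      List.filter_cons]
    by_cases h : (P ∩ Q).Nonempty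
    · simp [h, mulBlocks_cons]
    · have h0 : P ∩ Q = ∅ := Finset.not_nonempty_iff_eq_empty.mp h
      have : (N.map fun R => (P ∩ Q) ∩ R).filter (fun S => S.Nonempty) = [] := by
        simp [h0]
      rw [this]
      simp [h]

theorem mulBlocks_assoc {n : ℕ} (L M N : List (Finset (Fin n))) :
    mulBlocks (mulBlocks L M) N = mulBlocks L (mulBlocks M N) := by
  induction L with
  | nil => simp [mulBlocks]
  | cons P L ih =>
    rw [mulBlocks_cons, mulBlocks_append, ih, mulBlocks_cons, mulBlocks_assoc_aux]

namespace OrderedSetPartition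

variable {n : ℕ}

theorem filter_blocks (p : OrderedSetPartition n) :
    p.blocks.filter (fun P => P.Nonempty) = p.blocks :=
  List.filter_eq_self.mpr fun P hP => by simpa using p.nonempty P hP

/-- The product of ordered set partitions. -/
instance : Mul (OrderedSetPartition n) where
  mul p q :=
    { blocks := mulBlocks p.blocks q.blocks
      nonempty := fun P hP => (mem_mulBlocks.mp hP).2
      disjoint := by
        refine List.Pairwise.filter _ (List.pairwise_flatMap.mpr ⟨fun P _ => ?_, ?_⟩)
        · refine List.pairwise_map.mpr (q.disjoint.imp fun h => ?_)
          exact h.mono Finset.inter_subset_right Finset.inter_subset_right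
        · refine p.disjoint.imp fun h x hx y hy => ?_
          obtain ⟨_, _, rfl⟩ := List.mem_map.mp hx
          obtain ⟨_, _, rfl⟩ := List.mem_map.mp hy
          exact h.mono Finset.inter_subset_left Finset.inter_subset_left
      cover := fun i => by
        obtain ⟨P, hP, hi⟩ := p.cover i
        obtain ⟨Q, hQ, hi'⟩ := q.cover i
        have h : i ∈ P ∩ Q := Finset.mem_inter.mpr ⟨hi, hi'⟩
        exact ⟨P ∩ Q, mem_mulBlocks.mpr ⟨⟨P, hP, Q, hQ, rfl⟩, i, h⟩, h⟩ }

/-- The ordered set partition with one block (with no block if the set is empty). -/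
instance : One (OrderedSetPartition n) where
  one :=
    { blocks := [Finset.univ].filter fun P => P.Nonempty
      nonempty := by simp
      disjoint := List.Pairwise.filter _ (List.pairwise_singleton _ _)
      cover := fun i => ⟨Finset.univ, List.mem_filter.mpr
        ⟨List.mem_singleton_self _, decide_eq_true ⟨i, Finset.mem_univ i⟩⟩, Finset.mem_univ i⟩ }

theorem blocks_mul (p q : OrderedSetPartition n) :
    (p * q).blocks = mulBlocks p.blocks q.blocks := rfl

theorem blocks_one :
    (1 : OrderedSetPartition n).blocks = [Finset.univ].filter fun P => P.Nonempty := rfl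

/-- The monoid of ordered set partitions. -/
instance : Monoid (OrderedSetPartition n) where
  mul_assoc p q r := by
    ext1
    simp only [blocks_mul, mulBlocks_assoc]
  one_mul p := by
    ext1
    rcases isEmpty_or_nonempty (Fin n) with h | h
    · have : p.blocks = [] := List.eq_nil_iff_forall_not_mem.mpr fun P hP =>
        h.false (p.nonempty P hP).choose
      simp [blocks_mul, blocks_one, this, mulBlocks]
    · have : (Finset.univ : Finset (Fin n)).Nonempty := Finset.univ_nonempty
      simp only [blocks_mul, blocks_one, mulBlocks]
      simpa [List.filter_cons, this] using p.filter_blocks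
  mul_one p := by
    ext1
    rcases isEmpty_or_nonempty (Fin n) with h | h
    · have : p.blocks = [] := List.eq_nil_iff_forall_not_mem.mpr fun P hP =>
        h.false (p.nonempty P hP).choose
      simp [blocks_mul, this, mulBlocks]
    · have : (Finset.univ : Finset (Fin n)).Nonempty := Finset.univ_nonempty
      simp only [blocks_mul, blocks_one, mulBlocks]
      simpa [List.filter_cons, this, List.flatMap_singleton'] using p.filter_blocks

/-- The underlying (unordered) set partition `σ(π)`. Mathlib orders `Finpartition`s by refinement:
`X ≤ Y` means that every block of `X` is contained in a block of `Y`. -/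
def toFinpartition (p : OrderedSetPartition n) :
    Finpartition (Finset.univ : Finset (Fin n)) where
  parts := p.blocks.toFinset
  supIndep := by
    rw [Finset.supIndep_iff_pairwiseDisjoint]
    intro P hP Q hQ hPQ
    exact p.disjoint.forall (by simpa using hP) (by simpa using hQ) hPQ
  sup_parts := by
    refine Finset.eq_univ_of_forall fun i => ?_
    obtain ⟨P, hP, hi⟩ := p.cover i
    exact Finset.mem_sup.mpr ⟨P, by simpa using hP, hi⟩
  bot_notMem h := by
    have := p.nonempty _ (List.mem_toFinset.mp h)
    simp at this

theorem mem_toFinpartition {p : OrderedSetPartition n} {P : Finset (Fin n)} :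
    P ∈ p.toFinpartition.parts ↔ P ∈ p.blocks := List.mem_toFinset

theorem le_toFinpartition_one (X : Finpartition (Finset.univ : Finset (Fin n))) :
    X ≤ (1 : OrderedSetPartition n).toFinpartition := fun P hP =>
  ⟨Finset.univ, mem_toFinpartition.mpr (by
    obtain ⟨i, -⟩ := X.nonempty_of_mem_parts hP
    exact List.mem_filter.mpr
      ⟨List.mem_singleton_self _, decide_eq_true ⟨i, Finset.mem_univ i⟩⟩), Finset.subset_univ P⟩

theorem le_toFinpartition_mul {X : Finpartition (Finset.univ : Finset (Fin n))}
    {p q : OrderedSetPartition n} :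
    X ≤ (p * q).toFinpartition ↔ X ≤ p.toFinpartition ∧ X ≤ q.toFinpartition := by
  constructor
  · intro h
    constructor <;> intro P hP <;> obtain ⟨R, hR, hPR⟩ := h hP <;>
      obtain ⟨⟨A, hA, B, hB, rfl⟩, -⟩ := mem_mulBlocks.mp (mem_toFinpartition.mp hR)
    · exact ⟨A, mem_toFinpartition.mpr hA, hPR.trans Finset.inter_subset_left⟩
    · exact ⟨B, mem_toFinpartition.mpr hB, hPR.trans Finset.inter_subset_right⟩
  · rintro ⟨hp, hq⟩ P hP
    obtain ⟨A, hA, hPA⟩ := hp hP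
    obtain ⟨B, hB, hPB⟩ := hq hP
    have hsub : P ⊆ A ∩ B := Finset.subset_inter hPA hPB
    exact ⟨A ∩ B, mem_toFinpartition.mpr (mem_mulBlocks.mpr
      ⟨⟨A, mem_toFinpartition.mp hA, B, mem_toFinpartition.mp hB, rfl⟩,
        (X.nonempty_of_mem_parts hP).mono hsub⟩), hsub⟩

end OrderedSetPartition

/-! ### The subgroups `G_X` and the monoid of ordered `G`-partitions -/

/-- The subgroup `G_X` of `G ^ n`: the tuples that are constant on every block of `X`. -/
def blockSubgroup {n : ℕ} (G : Type v) [Group G]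
    (X : Finpartition (Finset.univ : Finset (Fin n))) : Subgroup (Fin n → G) where
  carrier := {g | ∀ P ∈ X.parts, ∀ i ∈ P, ∀ j ∈ P, g i = g j}
  mul_mem' {a b} ha hb P hP i hi j hj := by
    simp [ha P hP i hi j hj, hb P hP i hi j hj]
  one_mem' _ _ _ _ _ _ := rfl
  inv_mem' {a} ha P hP i hi j hj := by
    simp [ha P hP i hi j hj]

theorem blockSubgroup_anti {n : ℕ} {G : Type v} [Group G]
    {X Y : Finpartition (Finset.univ : Finset (Fin n))} (h : X ≤ Y) :
    blockSubgroup G Y ≤ blockSubgroup G X := by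
  intro g hg P hP i hi j hj
  obtain ⟨Q, hQ, hPQ⟩ := h hP
  exact hg Q hQ i (hPQ hi) j (hPQ hj)

/-- The homomorphism `G_X → G`, `g ↦ g_P`, where `g_P` is the common value of `g` on the block
`P` of `X`. -/
def blockValue {n : ℕ} (G : Type v) [Group G]
    (X : Finpartition (Finset.univ : Finset (Fin n))) (P : {P // P ∈ X.parts}) :
    blockSubgroup G X →* G where
  toFun g := g.1 (P.1.min' (X.nonempty_of_mem_parts P.2))
  map_one' := rfl
  map_mul' _ _ := rfl

theorem blockValue_eq {n : ℕ} {G : Type v} [Group G]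
    {X : Finpartition (Finset.univ : Finset (Fin n))} (P : {P // P ∈ X.parts})
    (g : blockSubgroup G X) {p : Fin n} (hp : p ∈ P.1) : blockValue G X P g = g.1 p :=
  g.2 P.1 P.2 _ (Finset.min'_mem _ _) p hp

/-- The monoid of ordered `G`-partitions: the submonoid of the product of the monoid of ordered
set partitions with `G ^ n` that consists of the pairs `(π, g)` with `g` constant on the blocks
of `π`. -/
def GPartitionMonoid (n : ℕ) (G : Type v) [Group G] :
    Submonoid (OrderedSetPartition n × (Fin n → G)) where
  carrier := {m | m.2 ∈ blockSubgroup G m.1.toFinpartition}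
  one_mem' := one_mem (blockSubgroup G (1 : OrderedSetPartition n).toFinpartition)
  mul_mem' {a b} ha hb := by
    have h := OrderedSetPartition.le_toFinpartition_mul.mp
      (le_refl (a.1 * b.1).toFinpartition)
    exact mul_mem (blockSubgroup_anti h.1 ha) (blockSubgroup_anti h.2 hb)

/-! ### Representations -/

section Representations

variable {K : Type u} [Field K]

/-- The tensor product `⨂ i, V i` of representations of a monoid `G`, with the diagonal action. -/
noncomputable def tensorRep {ι : Type*} {G : Type v} [Monoid G] {V : ι → Type w}
    [∀ i, AddCommGroup (V i)] [∀ i, Module K (V i)] (ρ : ∀ i, Representation K G (V i)) :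
    Representation K G (⨂[K] i, V i) where
  toFun g := PiTensorProduct.map fun i => ρ i g
  map_one' := by simp
  map_mul' g h := by simpa using PiTensorProduct.map_mul (fun i => ρ i g) (fun i => ρ i h)

variable {G : Type v} [Group G] {n : ℕ}

/-- The outer tensor product of representations `V P` of `G`, one for each block `P` of `X`:
`g ∈ G_X` acts on `⨂ P, V P` through `g_P` on the factor `V P`. -/
noncomputable def outerTensorRep (X : Finpartition (Finset.univ : Finset (Fin n)))
    {V : {P // P ∈ X.parts} → Type w} [∀ P, AddCommGroup (V P)] [∀ P, Module K (V P)]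
    (ρ : ∀ P, Representation K G (V P)) :
    Representation K (blockSubgroup G X) (⨂[K] P, V P) :=
  tensorRep fun P => (ρ P).comp (blockValue G X P)

open Classical in
/-- Inflation of a representation of `G_X` to the monoid of ordered `G`-partitions: `(π, g)` acts
as `g ∈ G_X` if the partition underlying `π` is coarser than or equal to `X`, and as `0`
otherwise. -/
noncomputable def inflateRep (X : Finpartition (Finset.univ : Finset (Fin n)))
    {V : Type w} [AddCommGroup V] [Module K V] (ρ : Representation K (blockSubgroup G X) V) :
    Representation K (GPartitionMonoid n G) V where
  toFun m := if h : X ≤ m.1.1.toFinpartition then ρ ⟨m.1.2, blockSubgroup_anti h m.2⟩ else 0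
  map_one' := by
    have h : X ≤ (1 : GPartitionMonoid n G).1.1.toFinpartition :=
      OrderedSetPartition.le_toFinpartition_one X
    rw [dif_pos h]
    exact map_one ρ
  map_mul' a b := by
    have hab : X ≤ (a * b).1.1.toFinpartition ↔
        X ≤ a.1.1.toFinpartition ∧ X ≤ b.1.1.toFinpartition :=
      OrderedSetPartition.le_toFinpartition_mul
    by_cases ha : X ≤ a.1.1.toFinpartition
    · by_cases hb : X ≤ b.1.1.toFinpartition
      · rw [dif_pos ha, dif_pos hb, dif_pos (hab.mpr ⟨ha, hb⟩), ← map_mul]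
        rfl
      · rw [dif_neg hb, dif_neg (fun h => hb (hab.mp h).2), mul_zero]
    · rw [dif_neg ha, dif_neg (fun h => ha (hab.mp h).1), zero_mul]

/-- The module `(X, f)` over the algebra of the monoid of ordered `G`-partitions, for a
set partition `X` and a family `f` of `KG`-modules, one for each block of `X`. -/
noncomputable def simpleMod (X : Finpartition (Finset.univ : Finset (Fin n)))
    {V : {P // P ∈ X.parts} → Type (max u v)} [∀ P, AddCommGroup (V P)] [∀ P, Module K (V P)]
    (f : ∀ P, Representation K G (V P)) :
    ModuleCat.{max u v} K[GPartitionMonoid n G] :=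
  ModuleCat.of K[GPartitionMonoid n G] (inflateRep X (outerTensorRep X f)).asModule

/-- Extension of scalars of a representation along `K → L`. -/
noncomputable def baseChangeRep {V : Type w} [AddCommGroup V] [Module K V]
    (L : Type*) [Field L] [Algebra K L] (ρ : Representation K G V) :
    Representation L G (L ⊗[K] V) :=
  (Module.End.baseChangeHom K L V : Module.End K V →* Module.End L (L ⊗[K] V)).comp ρ

/-- `K` is a splitting field for `G`: every simple `KG`-module remains simple after extension of
scalars to the algebraic closure of `K`. -/
def IsSplittingFieldFor (K : Type u) [Field K] (G : Type v) [Group G] : Prop :=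
  ∀ (V : Type (max u v)) [AddCommGroup V] [Module K V] (ρ : Representation K G V),
    ρ.IsIrreducible → (baseChangeRep (AlgebraicClosure K) ρ).IsIrreducible

end Representations

end Hsiao

/-! Regard `(X, f)` as a representation `V` of `G_X`. It has an explicit projective resolution over
the monoid algebra: the term of degree `k` consists of the chains with coefficients in `V` on the
ordered set partitions `π` with `X ≤ σ(π)` and `|σ(π)| = |X| - k`. An element `(μ, g)` sends `π ⊗ v`
to `μπ ⊗ gv` if `σ(π) ≤ σ(μ)`, and to `0` otherwise. These `π` are the `k`-dimensional faces of the
permutohedron on the blocks of `X`; the differential splits a block into two.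

A morphism from such a term to `(Y, h)` is determined by its values on one ordering of `Y`. It is a
`G_Y`-map from `V` to the space of `(Y, h)` if `X ≤ Y` and `k = |X| - |Y|`, and it is zero otherwise
(`chainRepHomEquiv`, `subsingleton_intertwiningMap_chainRep`). So at most one term of the resolution
has non-zero morphisms to `(Y, h)`, and `Ext` is the space of these morphisms, placed in the degree
of that term (`of_resolution`). As `G_Y` is a power of `G`, averaging over the group splits the
space of `G_Y`-maps between outer tensor products into a tensor product over the blocks of `Y`
(`nonempty_tensor_intertwiningMap`), once the blocks of `X` are grouped by the blocks of `Y` that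
contain them.

Three properties of the complex remain. Its terms are projective (`projective_chainRep`): the
multiplication map from a free module has a section, built from an average over `G_Y` and a product
of elements `1 - m` that is annihilated from the left by everything whose support is not above `Y`.
It is exact (`exists_eq_bd_add_single`): for a block `B` of `X`, an explicit homotopy pushes every
chain onto lists that end in `B`, which leaves the complex for one block less. Its differential is
equivariant (`signedBd_actL_single`): conjugation by a sign of lists makes the coefficients
independent of the order of the blocks and antisymmetric in the two parts of a split block. The
antisymmetry cancels the terms that survive the action although `π` itself is killed. -/

namespace CategoryTheory.Abelian.Ext

/-! ### `Ext` from a projective resolution with one relevant term -/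

open Limits

variable {C : Type u} [Category.{v} C] [Abelian C] [HasExt.{w} C]

/-- This and the next lemma are dimension shifting: the neighbouring groups in the contravariant
long exact sequence are `Ext` groups of the middle term. -/
theorem extClass_precomp_injective {S : ShortComplex C} (hS : S.ShortExact) (T : C)
    {n : ℕ} [Subsingleton (Ext S.X₂ T n)] :
    Function.Injective fun x : Ext S.X₁ T n => hS.extClass.comp x (add_comm 1 n) := by
  refine (injective_iff_map_eq_zero (hS.extClass.precomp T (add_comm 1 n))).mpr fun x hx => ?_
  obtain ⟨z, rfl⟩ := contravariant_sequence_exact₁ hS T x (add_comm 1 n) hx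
  rw [Subsingleton.elim z 0, comp_zero]

theorem extClass_precomp_surjective {S : ShortComplex C} (hS : S.ShortExact) (T : C)
    {n : ℕ} [Subsingleton (Ext S.X₂ T (n + 1))] :
    Function.Surjective fun x : Ext S.X₁ T n => hS.extClass.comp x (add_comm 1 n) := fun y =>
  contravariant_sequence_exact₃ hS T y (Subsingleton.elim _ _) (add_comm 1 n)

theorem subsingleton_succ_of_shortExact {S : ShortComplex C} (hS : S.ShortExact) (T : C)
    {n : ℕ} [Subsingleton (Ext S.X₂ T (n + 1))]
    [Subsingleton (Ext S.X₁ T n)] : Subsingleton (Ext S.X₃ T (n + 1)) :=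
  (extClass_precomp_surjective hS T).subsingleton

theorem mk₀_precomp_injective {S : ShortComplex C} (hS : S.ShortExact) (T : C) :
    Function.Injective fun x : Ext S.X₃ T 0 => (mk₀ S.g).comp x (add_zero 0) := by
  have := hS.epi_g
  exact precomp_mk₀_injective_of_epi T S.g

theorem mk₀_precomp_surjective {S : ShortComplex C} (hS : S.ShortExact) (T : C)
    [Subsingleton (Ext S.X₁ T 0)] :
    Function.Surjective fun x : Ext S.X₃ T 0 => (mk₀ S.g).comp x (add_zero 0) := fun y =>
  contravariant_sequence_exact₂ hS T y (Subsingleton.elim _ _)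

theorem subsingleton_zero_iff {X Y : C} : Subsingleton (Ext X Y 0) ↔ Subsingleton (X ⟶ Y) :=
  addEquiv₀.toEquiv.subsingleton_congr

variable (S : ℕ → ShortComplex C) (T : C)

/-- Dimension shifting lowers the degree of `Ext` while passing to the next syzygy. In degree zero,
the morphisms from a syzygy embed into those from the projective that covers it. -/
theorem subsingleton_of_resolution (hS : ∀ k, (S k).ShortExact)
    (hproj : ∀ k, Projective (S k).X₂) (e : ∀ k, (S k).X₁ = (S (k + 1)).X₃)
    (hT : ∀ k, Subsingleton ((S k).X₂ ⟶ T)) (q : ℕ) :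
    ∀ k, Subsingleton (Ext (S k).X₃ T q) := by
  induction q with
  | zero =>
    intro k
    have := subsingleton_zero_iff.mpr (hT k)
    exact (mk₀_precomp_injective (hS k) T).subsingleton
  | succ q ih =>
    intro k
    have := hproj k
    have : Subsingleton (Ext (S k).X₂ T (q + 1)) := subsingleton_of_projective _ _ _
    have : Subsingleton (Ext (S k).X₁ T q) := e k ▸ ih (k + 1)
    exact subsingleton_succ_of_shortExact (hS k) T

/-- If a projective resolution, given by its syzygies, has a single term with a non-zero morphism
to `T`, then the `Ext` groups to `T` are concentrated in the degree of this term. -/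
theorem of_resolution (K : Type*) [CommRing K] [Linear K C] (k₀ : ℕ) :
    ∀ (S : ℕ → ShortComplex C) (_ : ∀ k, (S k).ShortExact)
      (_ : ∀ k, Projective (S k).X₂) (_ : ∀ k, (S k).X₁ = (S (k + 1)).X₃)
      (_ : ∀ k, k ≠ k₀ → Subsingleton ((S k).X₂ ⟶ T)),
    (∀ q, q ≠ k₀ → Subsingleton (Ext (S 0).X₃ T q)) ∧
      Nonempty (Ext (S 0).X₃ T k₀ ≃ₗ[K] ((S k₀).X₂ ⟶ T)) := by
  induction k₀ with
  | zero =>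
    intro S hS hproj e hT
    -- The shifted sequence resolves the first syzygy, and none of its terms has a non-zero morphism
    -- to `T`.
    have h1 (q : ℕ) : Subsingleton (Ext (S 0).X₁ T q) := by
      rw [e 0]
      exact subsingleton_of_resolution (fun k => S (k + 1)) T (fun k => hS _) (fun k => hproj _)
        (fun k => e _) (fun k => hT _ (Nat.succ_ne_zero k)) q 0
    refine ⟨fun q hq => ?_, ⟨?_⟩⟩
    · obtain ⟨q, rfl⟩ := Nat.exists_eq_succ_of_ne_zero hq
      have := hproj 0
      have : Subsingleton (Ext (S 0).X₂ T (q + 1)) := subsingleton_of_projective _ _ _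
      exact subsingleton_succ_of_shortExact (hS 0) T
    · exact (LinearEquiv.ofBijective
        ((bilinearCompOfLinear K (S 0).X₂ (S 0).X₃ T 0 0 0 (add_zero 0)) (mk₀ (S 0).g))
        ⟨mk₀_precomp_injective (hS 0) T, mk₀_precomp_surjective (hS 0) T⟩).trans linearEquiv₀
  | succ k₀ ih =>
    intro S hS hproj e hT
    -- The shifted sequence resolves the first syzygy, with the relevant term now in degree `k₀`.
    obtain ⟨ih1, ⟨ih2⟩⟩ := ih (fun k => S (k + 1)) (fun k => hS _) (fun k => hproj _)
      (fun k => e _) (fun k hk => hT _ (by simpa using hk))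
    have e0 : (S 0).X₁ = (S (0 + 1)).X₃ := e 0
    rw [← e0] at ih2
    simp only [← e0] at ih1
    have := hproj 0
    have h2 : ∀ q, Subsingleton (Ext (S 0).X₂ T q)
      | 0 => subsingleton_zero_iff.mpr (hT 0 (Nat.succ_ne_zero k₀).symm)
      | q + 1 => subsingleton_of_projective _ _ _
    refine ⟨fun q hq => ?_, ⟨?_⟩⟩
    · obtain _ | q := q
      · exact (mk₀_precomp_injective (hS 0) T).subsingleton
      · have := ih1 q (by simpa using hq)
        exact subsingleton_succ_of_shortExact (hS 0) T
    · exact (LinearEquiv.ofBijective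
        ((bilinearCompOfLinear K (S 0).X₃ (S 0).X₁ T 1 k₀ (k₀ + 1) (add_comm 1 k₀))
          (hS 0).extClass)
        ⟨extClass_precomp_injective (hS 0) T, extClass_precomp_surjective (hS 0) T⟩).symm.trans ih2

end CategoryTheory.Abelian.Ext

/-! ### Tensor products of linear maps -/

namespace PiTensorProduct

/-- Over a field each factor has a linear left inverse, and these tensor to a left inverse. -/
theorem map_injective {K : Type*} [Field K] {ι : Type*} {V W : ι → Type*}
    [∀ i, AddCommGroup (V i)] [∀ i, Module K (V i)] [∀ i, AddCommGroup (W i)]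
    [∀ i, Module K (W i)] (f : ∀ i, V i →ₗ[K] W i) (hf : ∀ i, Function.Injective (f i)) :
    Function.Injective (map f) := by
  choose g hg using fun i => (f i).exists_leftInverse_of_injective (LinearMap.ker_eq_bot.mpr (hf i))
  refine Function.LeftInverse.injective (g := map g) fun x => ?_
  rw [← LinearMap.comp_apply, ← map_comp]
  simp [hg]

variable {K : Type*} [Field K] {ι : Type*} [Finite ι] {V W : ι → Type*}
  [∀ i, AddCommGroup (V i)] [∀ i, Module K (V i)] [∀ i, AddCommGroup (W i)] [∀ i, Module K (W i)]
  [∀ i, Module.Finite K (V i)] [∀ i, Module.Finite K (W i)]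

theorem finrank_eq_prod [Fintype ι] :
    Module.finrank K (⨂[K] i, V i) = ∏ i, Module.finrank K (V i) := by
  rw [Module.finrank_eq_nat_card_basis
    (Basis.piTensorProduct fun i => Module.finBasis K (V i)), Nat.card_pi]
  simp

/-- Tensor products of matrix units are the matrix units for the product bases. -/
theorem piTensorHomMap_surjective :
    Function.Surjective (piTensorHomMap (R := K) (s := V) (t := W)) := by
  classical
  have := Fintype.ofFinite ι
  let b := fun i => Module.finBasis K (V i)
  let c := fun i => Module.finBasis K (W i)
  let B := Basis.piTensorProduct b
  let C := Basis.piTensorProduct c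
  rw [← LinearMap.range_eq_top, eq_top_iff, ← (B.linearMap C).span_eq, Submodule.span_le]
  rintro _ ⟨⟨p, q⟩, rfl⟩
  refine ⟨tprod K fun i => (b i).linearMap (c i) (p i, q i), B.ext fun r => ?_⟩
  rw [Module.Basis.linearMap_apply_apply]
  simp only [B, C, Basis.piTensorProduct_apply, piTensorHomMap_tprod_tprod,
    Module.Basis.linearMap_apply_apply]
  split_ifs with h
  · exact congrArg _ (funext fun i => if_pos (congrFun h i))
  · obtain ⟨i, hi⟩ := Function.ne_iff.mp h
    exact (tprod K).map_coord_zero i (if_neg hi)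

/-- Source and target have the same finite dimension, so surjectivity suffices. -/
theorem piTensorHomMap_injective :
    Function.Injective (piTensorHomMap (R := K) (s := V) (t := W)) := by
  have := Fintype.ofFinite ι
  refine (LinearMap.injective_iff_surjective_of_finrank_eq_finrank ?_).mpr
    piTensorHomMap_surjective
  simp [finrank_eq_prod, Module.finrank_linearMap, Finset.prod_mul_distrib]

end PiTensorProduct

/-! ### Averaging, and morphisms between outer tensor products -/

namespace Representation

variable {K : Type*} [Field K] {G : Type*} [Group G] [Fintype G] {V W : Type*}
  [AddCommGroup V] [Module K V] [AddCommGroup W] [Module K W]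
  (ρ : Representation K G V) (σ : Representation K G W)

/-- The average of the conjugates of a linear map between representations of a finite group. -/
noncomputable def averageHom : (V →ₗ[K] W) →ₗ[K] IntertwiningMap ρ σ where
  toFun φ :=
    { toLinearMap := (Fintype.card G : K)⁻¹ • ∑ g, σ g ∘ₗ φ ∘ₗ ρ g⁻¹
      isIntertwining' := fun h => by
        ext v
        simp only [LinearMap.comp_apply, LinearMap.smul_apply, LinearMap.sum_apply, map_smul,
          map_sum]
        congr 1
        refine Fintype.sum_equiv (Equiv.mulLeft h⁻¹) _ _ fun g => ?_
        simp only [Equiv.coe_mulLeft, ← Module.End.mul_apply, ← map_mul]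
        simp }
  map_add' φ ψ := by
    ext v
    simp [Finset.sum_add_distrib]
  map_smul' c φ := by
    ext v
    simp [Finset.smul_sum, smul_comm c]

theorem averageHom_toLinearMap (φ : V →ₗ[K] W) :
    (averageHom ρ σ φ).toLinearMap = (Fintype.card G : K)⁻¹ • ∑ g, σ g ∘ₗ φ ∘ₗ ρ g⁻¹ := rfl

end Representation

namespace Hsiao

open PiTensorProduct Representation

theorem tensorRep_tprod {K : Type*} [Field K] {ι : Type*} {V : ι → Type w}
    [∀ i, AddCommGroup (V i)] [∀ i, Module K (V i)] {G : Type v} [Monoid G]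
    (ρ : ∀ i, Representation K G (V i)) (g : G) (x : ∀ i, V i) :
    tensorRep ρ g (tprod K x) = tprod K fun i => ρ i g (x i) :=
  map_tprod _ _

variable {K : Type*} [Field K] {ι : Type*} [Finite ι] {V : ι → Type*} {W : ι → Type*}
  [∀ i, AddCommGroup (V i)] [∀ i, Module K (V i)] [∀ i, AddCommGroup (W i)] [∀ i, Module K (W i)]
  [∀ i, Module.Finite K (V i)] [∀ i, Module.Finite K (W i)]
  {G : Type v} [Group G] [Finite G] {H : Type v} [Group H]

set_option maxHeartbeats 800000 in
/-- Intertwining maps between outer tensor products of representations of a finite group are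
tensor products of intertwining maps. -/
theorem nonempty_tensor_intertwiningMap (hG : (Nat.card G : K) ≠ 0)
    (χ : ∀ _ : ι, H →* G) (hχ : Function.Bijective fun h i => χ i h)
    (ρ : ∀ i, Representation K G (V i)) (σ : ∀ i, Representation K G (W i)) :
    Nonempty ((⨂[K] i, IntertwiningMap (ρ i) (σ i)) ≃ₗ[K]
      IntertwiningMap (tensorRep fun i => (ρ i).comp (χ i))
        (tensorRep fun i => (σ i).comp (χ i))) := by
  classical
  have := Fintype.ofFinite ι
  have := Fintype.ofFinite G
  let e : H ≃ (ι → G) := Equiv.ofBijective _ hχ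
  let _ : Fintype H := Fintype.ofEquiv _ e.symm
  have hH : ((Fintype.card H : ℕ) : K) = (Fintype.card G : K) ^ Fintype.card ι := by
    rw [Fintype.card_congr e, Fintype.card_fun, Nat.cast_pow]
  rw [Nat.card_eq_fintype_card] at hG
  have hH0 : ((Fintype.card H : ℕ) : K) ≠ 0 := hH ▸ pow_ne_zero _ hG
  let inc := fun i => IntertwiningMap.toLinearMapl (ρ := ρ i) (σ := σ i)
  let Ψ := piTensorHomMap (R := K) (s := V) (t := W) ∘ₗ PiTensorProduct.map inc
  let R₁ : Representation K H (⨂[K] i, V i) := tensorRep fun i => (ρ i).comp (χ i)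
  let R₂ : Representation K H (⨂[K] i, W i) := tensorRep fun i => (σ i).comp (χ i)
  have hΨ : Function.Injective Ψ := by
    exact piTensorHomMap_injective.comp
      (map_injective inc fun i => IntertwiningMap.toLinearMap_injective (ρ i) (σ i))
  let inc' := IntertwiningMap.toLinearMapl (ρ := R₁) (σ := R₂)
  have hinc' : Function.Injective inc' := IntertwiningMap.toLinearMap_injective R₁ R₂
  have hΨt (f : ∀ i, IntertwiningMap (ρ i) (σ i)) :
      Ψ (tprod K f) = PiTensorProduct.map fun i => (f i).toLinearMap := by
    simp only [Ψ, LinearMap.comp_apply, map_tprod, piTensorHomMap_tprod_eq_map, inc,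
      IntertwiningMap.toLinearMapl_apply]
  -- Averaging a tensor product of maps over `H ≅ G ^ ι` is averaging each factor over `G`: the
  -- product of sums over `G` expands to a sum over `ι → G`, and `1 / |H|` is the product of the
  -- factors `1 / |G|`.
  have key : Ψ ∘ₗ PiTensorProduct.map (fun i => averageHom (ρ i) (σ i)) =
      inc' ∘ₗ averageHom R₁ R₂ ∘ₗ piTensorHomMap (R := K) (s := V) (t := W) := by
    refine PiTensorProduct.ext (MultilinearMap.ext fun φ => ?_)
    refine PiTensorProduct.ext (MultilinearMap.ext fun x => ?_)
    simp only [LinearMap.compMultilinearMap_apply, LinearMap.comp_apply, Ψ, inc, inc', map_tprod,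
      IntertwiningMap.toLinearMapl_apply, averageHom_toLinearMap, piTensorHomMap_tprod_tprod,
      LinearMap.smul_apply, LinearMap.sum_apply, R₁, R₂, tensorRep_tprod]
    rw [MultilinearMap.map_smul_univ, MultilinearMap.map_sum, hH]
    simp only [Finset.prod_const, Finset.card_univ, inv_pow]
    congr 1
    refine Fintype.sum_equiv e.symm _ _ fun g => ?_
    have he (i : ι) : χ i (e.symm g) = g i := congrFun (e.apply_symm_apply g) i
    simp [MonoidHom.comp_apply, he]
  have hrange : LinearMap.range Ψ = LinearMap.range inc' := by
    apply le_antisymm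
    · rintro _ ⟨t, rfl⟩
      induction t using PiTensorProduct.induction_on with
      | smul_tprod r f =>
        let φ : IntertwiningMap R₁ R₂ :=
          { toLinearMap := PiTensorProduct.map fun i => (f i).toLinearMap
            isIntertwining' := fun h => by
              refine PiTensorProduct.ext (MultilinearMap.ext fun x => ?_)
              simp [R₁, R₂, tensorRep_tprod, IntertwiningMap.isIntertwining] }
        refine ⟨r • φ, ?_⟩
        rw [map_smul, map_smul]
        congr 1
        exact (hΨt f).symm
      | add x y hx hy =>
        rw [map_add]
        exact add_mem hx hy
    · rintro _ ⟨ψ, rfl⟩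
      -- An intertwining map comes from some `t` and equals its own average, so by `key` it is the
      -- image of the factorwise average of `t`.
      obtain ⟨t, ht⟩ := piTensorHomMap_surjective ψ.toLinearMap
      refine ⟨PiTensorProduct.map (fun i => averageHom (ρ i) (σ i)) t, ?_⟩
      rw [← LinearMap.comp_apply, key]
      simp only [LinearMap.comp_apply, ht, inc']
      ext1
      ext1 x
      simp only [IntertwiningMap.toLinearMapl_apply, averageHom_toLinearMap,
        LinearMap.compMultilinearMap_apply,
        LinearMap.smul_apply, LinearMap.sum_apply, LinearMap.comp_apply]
      have : ∀ h : H, R₂ h (ψ.toLinearMap (R₁ h⁻¹ (tprod K x))) = ψ.toLinearMap (tprod K x) := by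
        intro h
        rw [IntertwiningMap.toLinearMap_apply, ← ψ.isIntertwining, ← Module.End.mul_apply, ← map_mul]
        simp
      rw [Finset.sum_congr rfl fun h _ => this h]
      simp [← Nat.cast_smul_eq_nsmul K, smul_smul, hH0]
  exact ⟨(LinearEquiv.ofInjective Ψ hΨ).trans ((LinearEquiv.ofEq _ _ hrange).trans
    (LinearEquiv.ofInjective inc' hinc').symm)⟩

end Hsiao

/-! ### Regrouping the factors of a tensor product -/

namespace PiTensorProduct

section Regroup

variable {K : Type*} [Field K] {ι κ : Type*} {r : κ → ι → Prop} (hr : ∀ q, ∃! p, r q p)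
  (V : κ → Type*) [∀ q, AddCommGroup (V q)] [∀ q, Module K (V q)]

open Function in
-- A change of the factor `q` affects only the outer factor `p` with `r q p`. Multilinearity of the
-- grouped tensor thus reduces to that of the outer and of one inner tensor product.
theorem tprod_tprod_update [DecidableEq ι] [DecidableEq κ] {q : κ} {p : ι} (hqp : r q p)
    (hr : ∀ p', r q p' → p' = p) (v : ∀ q, V q) (x : V q) :
    (fun p => tprod K fun q' : {q // r q p} => update v q x q'.1) =
      update (fun p => tprod K fun q' : {q // r q p} => v q'.1) p
        (tprod K (update (fun q' : {q // r q p} => v q'.1) ⟨q, hqp⟩ x)) := by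
  funext p'
  by_cases h : p' = p
  · subst h
    rw [update_self]
    congr 1
    funext ⟨q', hq'⟩
    by_cases h' : q' = q
    · subst h'
      simp
    · rw [update_of_ne h', update_of_ne fun h => h' (congrArg Subtype.val h)]
  · rw [update_of_ne h]
    congr 1
    funext ⟨q', hq'⟩
    exact update_of_ne (by rintro rfl; exact h (hr _ hq')) _ _

include hr

/-- The map from a tensor product to the iterated tensor product obtained by grouping the
factors. -/
noncomputable def regroup :
    (⨂[K] q, V q) →ₗ[K] ⨂[K] p : ι, ⨂[K] q : {q // r q p}, V q.1 :=
  lift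
    { toFun := fun v => tprod K fun p => tprod K fun q : {q // r q p} => v q.1
      map_update_add' := by
        classical
        intro _ v q x y
        obtain ⟨p, hp, hp'⟩ := hr q
        have key := tprod_tprod_update (K := K) V hp hp' v
        convert_to tprod K (fun p => tprod K fun q' : {q // r q p} =>
          Function.update v q (x + y) q'.1) = tprod K (fun p => tprod K fun q' : {q // r q p} =>
          Function.update v q x q'.1) + tprod K (fun p => tprod K fun q' : {q // r q p} =>
          Function.update v q y q'.1)
        rw [key, key, key, MultilinearMap.map_update_add, MultilinearMap.map_update_add]
      map_update_smul' := by
        classical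
        intro _ v q c x
        obtain ⟨p, hp, hp'⟩ := hr q
        have key := tprod_tprod_update (K := K) V hp hp' v
        convert_to tprod K (fun p => tprod K fun q' : {q // r q p} =>
          Function.update v q (c • x) q'.1) = c • tprod K (fun p =>
          tprod K fun q' : {q // r q p} => Function.update v q x q'.1)
        rw [key, key, MultilinearMap.map_update_smul, MultilinearMap.map_update_smul] }

theorem regroup_tprod (v : ∀ q, V q) :
    regroup (K := K) hr V (tprod K v) =
      tprod K fun p => tprod K fun q : {q // r q p} => v q.1 :=
  lift.tprod _

/-- Product bases are carried to iterated product bases, up to the bijection `e` of index sets. -/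
theorem regroup_bijective [Finite ι] [Finite κ] [∀ q, Module.Finite K (V q)] :
    Function.Bijective (regroup (K := K) hr V) := by
  have hr' := hr
  choose π hπ hπ' using hr'
  let b := fun q => Module.finBasis K (V q)
  let B := Basis.piTensorProduct b
  let D := Basis.piTensorProduct fun p : ι => Basis.piTensorProduct fun q : {q // r q p} => b q.1
  let e : (∀ q, Fin (Module.finrank K (V q))) ≃
      ∀ p, ∀ q : {q // r q p}, Fin (Module.finrank K (V q.1)) :=
    { toFun := fun x p q => x q.1
      invFun := fun y q => y (π q) ⟨q, hπ q⟩
      left_inv := fun x => rfl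
      right_inv := fun y => by
        funext p ⟨q, hq⟩
        obtain rfl := hπ' q p hq
        rfl }
  have : regroup (K := K) hr V = (B.equiv D e).toLinearMap := B.ext fun x => by
    simp only [LinearEquiv.coe_coe, Module.Basis.equiv_apply]
    simp only [B, D, Basis.piTensorProduct_apply, regroup_tprod]
    rfl
  rw [this]
  exact (B.equiv D e).bijective

end Regroup

end PiTensorProduct

/-! ### Generalities on representations -/

namespace Representation

/-- Precomposition with an equivalence of representations. -/
def IntertwiningMap.congrLeft {K G V V' W : Type*} [Field K] [Monoid G]
    [AddCommGroup V] [Module K V] [AddCommGroup V'] [Module K V'] [AddCommGroup W] [Module K W]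
    {ρ : Representation K G V} {ρ' : Representation K G V'} (e : Equiv ρ ρ')
    (σ : Representation K G W) : IntertwiningMap ρ' σ ≃ₗ[K] IntertwiningMap ρ σ where
  toFun φ := φ.comp e.toIntertwiningMap
  map_add' _ _ := rfl
  map_smul' _ _ := rfl
  invFun φ := φ.comp e.symm.toIntertwiningMap
  left_inv φ := by
    apply DFunLike.coe_injective
    funext x
    exact congrArg φ (e.toLinearEquiv.apply_symm_apply x)
  right_inv φ := by
    apply DFunLike.coe_injective
    funext x
    exact congrArg φ (e.toLinearEquiv.symm_apply_apply x)

/-- An irreducible representation of a finite group is finite-dimensional. -/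
theorem IsIrreducible.finite {K G V : Type*} [Field K] [Group G] [Finite G]
    [AddCommGroup V] [Module K V] {ρ : Representation K G V} (h : ρ.IsIrreducible) :
    Module.Finite K V := by
  classical
  obtain ⟨⟨A, B, hAB⟩⟩ := h.toNontrivial
  have : Nontrivial V := by
    by_contra hV
    rw [not_nontrivial_iff_subsingleton] at hV
    refine hAB (SetLike.ext fun x => ?_)
    rw [Subsingleton.elim x 0]
    exact iff_of_true A.toSubmodule.zero_mem B.toSubmodule.zero_mem
  obtain ⟨x, hx⟩ := exists_ne (0 : V)
  let S : Subrepresentation ρ :=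
    { toSubmodule := Submodule.span K (Set.range fun g => ρ g x)
      apply_mem_toSubmodule := fun g y hy => by
        have : Submodule.span K (Set.range fun g => ρ g x) ≤
            (Submodule.span K (Set.range fun g => ρ g x)).comap (ρ g) := by
          rw [Submodule.span_le]
          rintro _ ⟨k, rfl⟩
          refine Submodule.subset_span ⟨g * k, ?_⟩
          simp
        exact this hy }
  have hS : S = ⊤ := by
    refine (h.eq_bot_or_eq_top S).resolve_left fun h0 => hx ?_
    have hmem : x ∈ S.toSubmodule := Submodule.subset_span ⟨1, by simp⟩
    rw [h0] at hmem
    exact (Submodule.mem_bot K).mp hmem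
  have hfin : (⊤ : Submodule K V).FG := by
    have : S.toSubmodule = ⊤ := by rw [hS]; rfl
    rw [← this]
    exact Submodule.fg_span (Set.finite_range _)
  exact ⟨hfin⟩

end Representation

/-! ### The groups `G_X` and morphisms between their outer tensor products -/

namespace Hsiao

open PiTensorProduct Representation

variable {n : ℕ} {G : Type v} [Group G]

theorem existsUnique_part {X : Finpartition (Finset.univ : Finset (Fin n))} (i : Fin n) :
    ∃! P : {P // P ∈ X.parts}, i ∈ P.1 := by
  obtain ⟨P, ⟨hP, hi⟩, h⟩ := X.existsUnique_mem (Finset.mem_univ i)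
  exact ⟨⟨P, hP⟩, hi, fun Q hQ => Subtype.ext (h _ ⟨Q.2, hQ⟩)⟩

theorem existsUnique_subset {X Y : Finpartition (Finset.univ : Finset (Fin n))} (hXY : X ≤ Y)
    (Q : {Q // Q ∈ X.parts}) : ∃! P : {P // P ∈ Y.parts}, Q.1 ⊆ P.1 := by
  obtain ⟨P, hP, hQP⟩ := hXY Q.2
  refine ⟨⟨P, hP⟩, hQP, fun R hR => ?_⟩
  obtain ⟨i, hi⟩ := X.nonempty_of_mem_parts Q.2
  exact (existsUnique_part i).unique (hR hi) (hQP hi)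

/-- This is the hypothesis of `nonempty_tensor_intertwiningMap` on the group `H = G_X`. -/
theorem blockValue_bijective (X : Finpartition (Finset.univ : Finset (Fin n))) :
    Function.Bijective fun (g : blockSubgroup G X) P => blockValue G X P g := by
  choose π hπ hπ' using existsUnique_part (X := X)
  constructor
  · intro g g' h
    ext i
    have := congrFun h (π i)
    simpa only [blockValue_eq (π i) _ (hπ i)] using this
  · intro a
    have ha : (fun i => a (π i)) ∈ blockSubgroup G X := fun P hP i hi j hj =>
      congrArg a ((hπ' i ⟨P, hP⟩ hi).symm.trans (hπ' j ⟨P, hP⟩ hj))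
    refine ⟨⟨_, ha⟩, funext fun P => ?_⟩
    obtain ⟨i, hi⟩ := X.nonempty_of_mem_parts P.2
    exact (blockValue_eq P ⟨_, ha⟩ hi).trans (congrArg a (hπ' i P hi).symm)

variable {K : Type u} [Field K] [Finite G]

theorem nonempty_intertwiningMap_outerTensorRep (hG : (Nat.card G : K) ≠ 0)
    {X Y : Finpartition (Finset.univ : Finset (Fin n))} (hXY : X ≤ Y)
    {V : {P // P ∈ X.parts} → Type w} [∀ P, AddCommGroup (V P)] [∀ P, Module K (V P)]
    [∀ P, Module.Finite K (V P)] (f : ∀ P, Representation K G (V P))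
    {W : {P // P ∈ Y.parts} → Type w} [∀ P, AddCommGroup (W P)] [∀ P, Module K (W P)]
    [∀ P, Module.Finite K (W P)] (h : ∀ P, Representation K G (W P)) :
    Nonempty (IntertwiningMap
      ((outerTensorRep X f).comp (Subgroup.inclusion (blockSubgroup_anti (G := G) hXY)))
      (outerTensorRep Y h) ≃ₗ[K]
      ⨂[K] P : {P // P ∈ Y.parts}, IntertwiningMap
        (tensorRep fun Q : {Q : {Q // Q ∈ X.parts} // Q.1 ⊆ P.1} => f Q.1) (h P)) := by
  obtain ⟨e⟩ := nonempty_tensor_intertwiningMap hG (fun P => blockValue G Y P)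
    (blockValue_bijective Y)
    (fun P => tensorRep fun Q : {Q : {Q // Q ∈ X.parts} // Q.1 ⊆ P.1} => f Q.1) h
  have hr := existsUnique_subset hXY
  -- Grouping the blocks `Q` of `X` by the blocks `P` of `Y` containing them is `G_Y`-equivariant,
  -- since `g_Q = g_P` for `Q ⊆ P`.
  refine ⟨(IntertwiningMap.congrLeft (Representation.Equiv.mk
    (LinearEquiv.ofBijective (regroup (K := K) hr V) (regroup_bijective hr V)) fun g => ?_)
    _).symm.trans e.symm⟩
  refine PiTensorProduct.ext (MultilinearMap.ext fun v => ?_)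
  simp only [LinearMap.compMultilinearMap_apply, LinearMap.comp_apply, outerTensorRep,
    MonoidHom.comp_apply, tensorRep_tprod, LinearEquiv.coe_coe, LinearEquiv.ofBijective_apply,
    regroup_tprod]
  congr 1
  funext P
  congr 1
  funext Q
  obtain ⟨i, hi⟩ := X.nonempty_of_mem_parts Q.1.2
  rw [blockValue_eq Q.1 _ hi, blockValue_eq P _ (Q.2 hi)]
  rfl

/-! ### Products of comparable ordered set partitions -/

theorem filter_inter_eq_singleton {n : ℕ} {P Q : Finset (Fin n)} {M : List (Finset (Fin n))}
    (hM : M.Pairwise Disjoint) (hQ : Q ∈ M) (hPQ : P ⊆ Q) (hP : P.Nonempty) :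
    ((M.map fun R => P ∩ R).filter fun R => R.Nonempty) = [P] := by
  induction M with
  | nil => simp at hQ
  | cons A M ih =>
    rw [List.pairwise_cons] at hM
    rw [List.map_cons, List.filter_cons]
    rcases List.mem_cons.mp hQ with rfl | hQ
    · have h0 : ((M.map fun R => P ∩ R).filter fun R => R.Nonempty) = [] := by
        refine List.filter_eq_nil_iff.mpr fun R hR => ?_
        obtain ⟨B, hB, rfl⟩ := List.mem_map.mp hR
        have := (hM.1 B hB).mono_left hPQ
        simp [Finset.disjoint_iff_inter_eq_empty.mp this]
      rw [h0, Finset.inter_eq_left.mpr hPQ]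
      simp [hP]
    · have : P ∩ A = ∅ :=
        Finset.disjoint_iff_inter_eq_empty.mp ((hM.1 Q hQ).symm.mono_left hPQ)
      rw [this]
      simpa using ih hM.2 hQ

namespace OrderedSetPartition

variable {n : ℕ} {π μ : OrderedSetPartition n}

/-- Each block of `π` lies in one block of `μ` and misses the others, so intersecting changes
nothing. -/
theorem mul_eq_left (h : π.toFinpartition ≤ μ.toFinpartition) : π * μ = π := by
  ext1
  rw [blocks_mul]
  have key : ∀ L : List (Finset (Fin n)), (∀ P ∈ L, P ∈ π.blocks) → mulBlocks L μ.blocks = L := by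
    intro L
    induction L with
    | nil => simp [mulBlocks]
    | cons P L ih =>
      intro hL
      obtain ⟨Q, hQ, hPQ⟩ := h (mem_toFinpartition.mpr (hL P (by simp)))
      rw [mulBlocks_cons, ih fun R hR => hL R (List.mem_cons_of_mem _ hR),
        filter_inter_eq_singleton μ.disjoint (mem_toFinpartition.mp hQ) hPQ
          (π.nonempty P (hL P (by simp)))]
      rfl
  exact key _ fun _ h => h

theorem toFinpartition_mul_of_le (h : π.toFinpartition ≤ μ.toFinpartition) :
    (μ * π).toFinpartition = π.toFinpartition :=
  le_antisymm (le_toFinpartition_mul.mp le_rfl).2 (le_toFinpartition_mul.mpr ⟨h, le_rfl⟩)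

theorem exists_toFinpartition_eq (Y : Finpartition (Finset.univ : Finset (Fin n))) :
    ∃ π : OrderedSetPartition n, π.toFinpartition = Y := by
  refine ⟨⟨Y.parts.toList, fun P hP => Y.nonempty_of_mem_parts (Finset.mem_toList.mp hP), ?_,
    fun i => ?_⟩, ?_⟩
  · refine Y.parts.nodup_toList.pairwise_of_forall_ne fun P hP Q hQ hPQ => ?_
    exact Y.disjoint (Finset.mem_toList.mp hP) (Finset.mem_toList.mp hQ) hPQ
  · obtain ⟨P, hP, hi⟩ := Y.exists_mem (Finset.mem_univ i)
    exact ⟨P, Finset.mem_toList.mpr hP, hi⟩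
  · ext P
    simp [mem_toFinpartition]

end OrderedSetPartition

open OrderedSetPartition

/-- An ordered set partition with underlying set partition `Y`. -/
noncomputable def ordering {n : ℕ} (Y : Finpartition (Finset.univ : Finset (Fin n))) :
    OrderedSetPartition n :=
  (exists_toFinpartition_eq Y).choose

theorem toFinpartition_ordering {n : ℕ} (Y : Finpartition (Finset.univ : Finset (Fin n))) :
    (ordering Y).toFinpartition = Y :=
  (exists_toFinpartition_eq Y).choose_spec

/-! ### Annihilating products in the monoid algebra -/

section Monoid

variable (n : ℕ) (G : Type v) [Group G]

/-- The inclusion of the monoid of ordered set partitions in the monoid of ordered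
`G`-partitions. -/
def inlHom : OrderedSetPartition n →* GPartitionMonoid n G where
  toFun π := ⟨(π, 1), one_mem (blockSubgroup G π.toFinpartition)⟩
  map_one' := rfl
  map_mul' π μ := by
    ext1
    simp

variable {n G}

/-- The support of an ordered `G`-partition. -/
def supp (m : GPartitionMonoid n G) : Finpartition (Finset.univ : Finset (Fin n)) :=
  m.1.1.toFinpartition

theorem snd_mem_blockSubgroup (m : GPartitionMonoid n G) : m.1.2 ∈ blockSubgroup G (supp m) := m.2

theorem supp_mul_le_left (a b : GPartitionMonoid n G) : supp (a * b) ≤ supp a :=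
  (le_toFinpartition_mul.mp le_rfl).1

theorem le_supp_mul {X : Finpartition (Finset.univ : Finset (Fin n))}
    {a b : GPartitionMonoid n G} : X ≤ supp (a * b) ↔ X ≤ supp a ∧ X ≤ supp b :=
  le_toFinpartition_mul

theorem mul_inlHom_eq_left {m : GPartitionMonoid n G} {π : OrderedSetPartition n}
    (h : supp m ≤ π.toFinpartition) : m * inlHom n G π = m := by
  ext1
  exact Prod.ext (mul_eq_left h) (mul_one m.1.2)

variable (K : Type u) [Field K]

/-- The product of the elements `1 - m`, for `m` in a list. -/
noncomputable def prodOneSub (l : List (OrderedSetPartition n)) : K[GPartitionMonoid n G] :=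
  (l.map fun π => 1 - MonoidAlgebra.of K (GPartitionMonoid n G) (inlHom n G π)).prod

/-- If `supp m ≤ σ(π)` then `m π = m`, so the factor `1 - π` kills `m`. An earlier factor replaces
`m` by a difference of elements whose supports are at most `supp m`, and these are killed for the
same reason. -/
theorem of_mul_prodOneSub {l : List (OrderedSetPartition n)} {m : GPartitionMonoid n G}
    (h : ∃ π ∈ l, supp m ≤ π.toFinpartition) :
    MonoidAlgebra.of K (GPartitionMonoid n G) m * prodOneSub K l = 0 := by
  induction l generalizing m with
  | nil => simp at h
  | cons π l ih =>
    rw [prodOneSub, List.map_cons, List.prod_cons, ← mul_assoc, mul_sub, mul_one, ← map_mul]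
    by_cases hπ : supp m ≤ π.toFinpartition
    · rw [mul_inlHom_eq_left hπ, sub_self, zero_mul]
    · obtain ⟨μ, hμ, hm⟩ := h
      have hμ' : μ ∈ l := (List.mem_cons.mp hμ).resolve_left fun h => hπ (h ▸ hm)
      rw [sub_mul]
      have h1 := ih ⟨μ, hμ', hm⟩
      have h2 := ih ⟨μ, hμ', (supp_mul_le_left m (inlHom n G π)).trans hm⟩
      rw [prodOneSub] at h1 h2
      rw [h1, h2, sub_zero]

theorem prodOneSub_smul {N : Type*} [AddCommGroup N] [Module K[GPartitionMonoid n G] N]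
    {l : List (OrderedSetPartition n)} {x : N}
    (h : ∀ π ∈ l, MonoidAlgebra.of K (GPartitionMonoid n G) (inlHom n G π) • x = 0) :
    prodOneSub (G := G) K l • x = x := by
  induction l with
  | nil => simp [prodOneSub]
  | cons π l ih =>
    rw [prodOneSub, List.map_cons, List.prod_cons, mul_smul, ← prodOneSub,
      ih fun μ hμ => h μ (List.mem_cons_of_mem _ hμ), sub_smul, one_smul, h π (by simp), sub_zero]

open Classical in
/-- Orderings of the set partitions that are not coarser than or equal to `Y`. -/
noncomputable def notAbove (Y : Finpartition (Finset.univ : Finset (Fin n))) :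
    List (OrderedSetPartition n) :=
  ((Finset.univ.filter fun Z => ¬ Y ≤ Z).toList).map ordering

/-- An ordering of `supp m` occurs in the list. By `prodOneSub_smul` the same product acts as the
identity on any vector that is killed by all members of `notAbove Y`, such as an ordering of `Y` in
a chain module. -/
theorem of_mul_prodOneSub_notAbove {m : GPartitionMonoid n G}
    {Y : Finpartition (Finset.univ : Finset (Fin n))} (h : ¬ Y ≤ supp m) :
    MonoidAlgebra.of K (GPartitionMonoid n G) m * prodOneSub K (notAbove Y) = 0 := by
  refine of_mul_prodOneSub K ⟨ordering (supp m), ?_, (toFinpartition_ordering _).ge⟩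
  simp only [notAbove, List.mem_map, Finset.mem_toList, Finset.mem_filter]
  exact ⟨_, ⟨Finset.mem_univ _, h⟩, rfl⟩

theorem not_le_of_mem_notAbove {Y : Finpartition (Finset.univ : Finset (Fin n))}
    {π : OrderedSetPartition n} (h : π ∈ notAbove Y) : ¬ Y ≤ π.toFinpartition := by
  simp only [notAbove, List.mem_map, Finset.mem_toList, Finset.mem_filter] at h
  obtain ⟨Z, ⟨-, hZ⟩, rfl⟩ := h
  rwa [toFinpartition_ordering]

end Monoid

/-! ### Modules of chains on ordered set partitions -/

section Chain

variable {K : Type u} [Field K] {G : Type v} [Group G] {n : ℕ}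
  {X : Finpartition (Finset.univ : Finset (Fin n))} {V : Type w} [AddCommGroup V] [Module K V]
  (ρ : Representation K (blockSubgroup G X) V)
  {p : Finpartition (Finset.univ : Finset (Fin n)) → Prop} (hp : ∀ Y, p Y → X ≤ Y)

open Classical in
/-- The action of an ordered `G`-partition on the chains with coefficients in `V` on the ordered
set partitions whose underlying set partition satisfies `p`. -/
noncomputable def chainMap (m : GPartitionMonoid n G) :
    ({π : OrderedSetPartition n // p π.toFinpartition} →₀ V) →ₗ[K]
      ({π : OrderedSetPartition n // p π.toFinpartition} →₀ V) :=
  Finsupp.lsum K fun π =>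
    if h : π.1.toFinpartition ≤ supp m then
      Finsupp.lsingle ⟨m.1.1 * π.1, (toFinpartition_mul_of_le h).symm ▸ π.2⟩ ∘ₗ
        ρ ⟨m.1.2, blockSubgroup_anti ((hp _ π.2).trans h) (snd_mem_blockSubgroup m)⟩
    else 0

/-- The index `π'` and the group element `g` are prescribed only up to equality of the underlying
data, which avoids casts along equalities of set partitions. -/
theorem chainMap_single_of_le {m : GPartitionMonoid n G}
    {π π' : {π : OrderedSetPartition n // p π.toFinpartition}}
    (h : π.1.toFinpartition ≤ supp m) (hπ : π'.1 = m.1.1 * π.1) {g : blockSubgroup G X}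
    (hg : g.1 = m.1.2) (v : V) :
    chainMap ρ hp m (Finsupp.single π v) = Finsupp.single π' (ρ g v) := by
  rw [chainMap, Finsupp.lsum_single, dif_pos h, LinearMap.comp_apply, Finsupp.lsingle_apply]
  obtain rfl : g = ⟨m.1.2, blockSubgroup_anti ((hp _ π.2).trans h) (snd_mem_blockSubgroup m)⟩ := Subtype.ext hg
  rw [show π' = ⟨m.1.1 * π.1, (toFinpartition_mul_of_le h).symm ▸ π.2⟩ from Subtype.ext hπ]

theorem chainMap_single_of_not_le {m : GPartitionMonoid n G}
    {π : {π : OrderedSetPartition n // p π.toFinpartition}} (h : ¬ π.1.toFinpartition ≤ supp m)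
    (v : V) : chainMap ρ hp m (Finsupp.single π v) = 0 := by
  rw [chainMap, Finsupp.lsum_single, dif_neg h]
  rfl

/-- The representation of the monoid of ordered `G`-partitions on the chains with coefficients in
`V` on the ordered set partitions whose underlying set partition satisfies `p`. -/
noncomputable def chainRep :
    Representation K (GPartitionMonoid n G)
      ({π : OrderedSetPartition n // p π.toFinpartition} →₀ V) where
  toFun := chainMap ρ hp
  map_one' := by
    refine Finsupp.lhom_ext fun π v => ?_
    have h : π.1.toFinpartition ≤ supp (1 : GPartitionMonoid n G) := le_toFinpartition_one _
    have hg : (1 : blockSubgroup G X).1 = (1 : GPartitionMonoid n G).1.2 := rfl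
    rw [chainMap_single_of_le ρ hp h (π' := π) (one_mul π.1).symm hg, map_one]
    rfl
  map_mul' a b := by
    refine Finsupp.lhom_ext fun π v => ?_
    rw [Module.End.mul_apply]
    by_cases hb : π.1.toFinpartition ≤ supp b
    · have hbπ := toFinpartition_mul_of_le hb
      let g : blockSubgroup G X :=
        ⟨b.1.2, blockSubgroup_anti ((hp _ π.2).trans hb) (snd_mem_blockSubgroup b)⟩
      let π' : {π : OrderedSetPartition n // p π.toFinpartition} := ⟨b.1.1 * π.1, hbπ.symm ▸ π.2⟩
      have e1 := chainMap_single_of_le ρ hp (m := b) (π := π) (π' := π') hb rfl (g := g) rfl v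
      rw [e1]
      by_cases ha : π.1.toFinpartition ≤ supp a
      · have ha' : π'.1.toFinpartition ≤ supp a := hbπ.trans_le ha
        let g' : blockSubgroup G X :=
          ⟨a.1.2, blockSubgroup_anti ((hp _ π.2).trans ha) (snd_mem_blockSubgroup a)⟩
        let π'' : {π : OrderedSetPartition n // p π.toFinpartition} :=
          ⟨a.1.1 * π'.1, (toFinpartition_mul_of_le ha').symm ▸ π'.2⟩
        have e2 := chainMap_single_of_le ρ hp (m := a) (π := π') (π' := π'') ha' rfl (g := g') rfl
          (ρ g v)
        have hπ : π''.1 = (a * b).1.1 * π.1 := (mul_assoc a.1.1 b.1.1 π.1).symm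
        have hg : (g' * g).1 = (a * b).1.2 := rfl
        rw [e2, chainMap_single_of_le ρ hp (m := a * b) (π := π) (π' := π'')
          (le_supp_mul.mpr ⟨ha, hb⟩) hπ hg, map_mul, Module.End.mul_apply]
      · have h1 : ¬ π.1.toFinpartition ≤ supp (a * b) := fun h => ha (le_supp_mul.mp h).1
        have h2 : ¬ π'.1.toFinpartition ≤ supp a := fun h => ha (hbπ.symm.trans_le h)
        exact (chainMap_single_of_not_le ρ hp h1 v).trans
          (chainMap_single_of_not_le ρ hp h2 (ρ g v)).symm
    · have h1 : ¬ π.1.toFinpartition ≤ supp (a * b) := fun h => hb (le_supp_mul.mp h).2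
      rw [chainMap_single_of_not_le ρ hp hb v, map_zero]
      exact chainMap_single_of_not_le ρ hp h1 v

theorem chainRep_apply (m : GPartitionMonoid n G) : chainRep ρ hp m = chainMap ρ hp m := rfl

end Chain

open OrderedSetPartition Representation

variable {K : Type u} [Field K] {G : Type v} [Group G] {n : ℕ}
  {X : Finpartition (Finset.univ : Finset (Fin n))} {V : Type w} [AddCommGroup V] [Module K V]
  (ρ : Representation K (blockSubgroup G X) V)
  {p : Finpartition (Finset.univ : Finset (Fin n)) → Prop} (hp : ∀ Y, p Y → X ≤ Y)

/-! ### Projectivity of the chain modules -/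

section Projective

/-- The ordered `G`-partition `(π, g)`, for `g` constant on the blocks of `π`. -/
def mkGPartition (π : OrderedSetPartition n) {Y : Finpartition (Finset.univ : Finset (Fin n))}
    (hY : π.toFinpartition = Y) (g : blockSubgroup G Y) : GPartitionMonoid n G :=
  ⟨(π, g.1), by subst hY; exact g.2⟩

/-- An ordering of a set partition, as an element of the index set of the chains. -/
noncomputable def orderingChain {Y : Finpartition (Finset.univ : Finset (Fin n))} (hY : p Y) :
    {π : OrderedSetPartition n // p π.toFinpartition} :=
  ⟨ordering Y, (toFinpartition_ordering Y).symm ▸ hY⟩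

theorem ofFn_smul (m : GPartitionMonoid n G) (x : (chainRep ρ hp).asModule) :
    MonoidAlgebra.of K (GPartitionMonoid n G) m • x = chainMap ρ hp m x := by
  rw [MonoidAlgebra.of_apply, single_smul, one_smul]
  rfl

variable [∀ Y, Fintype (blockSubgroup (n := n) G Y)]

/-- The section of the multiplication map `K[M] ⊗ C → C`, for the module `C` of chains. -/
noncomputable def chainSection (Y : Finpartition (Finset.univ : Finset (Fin n))) (hY : p Y)
    (π : OrderedSetPartition n) (hπ : π.toFinpartition = Y) :
    V →ₗ[K] K[GPartitionMonoid n G] ⊗[K] (chainRep ρ hp).asModule :=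
  (Fintype.card (blockSubgroup G Y) : K)⁻¹ • ∑ g : blockSubgroup G Y,
    TensorProduct.mk K _ _ (MonoidAlgebra.of K (GPartitionMonoid n G) (mkGPartition π hπ g) *
        prodOneSub K (notAbove Y)) ∘ₗ
      (chainRep ρ hp).asModuleEquiv.symm.toLinearMap ∘ₗ Finsupp.lsingle (orderingChain hY) ∘ₗ
        ρ (Subgroup.inclusion (blockSubgroup_anti (hp Y hY)) g⁻¹)

theorem chainSection_apply (Y : Finpartition (Finset.univ : Finset (Fin n))) (hY : p Y)
    (π : OrderedSetPartition n) (hπ : π.toFinpartition = Y) (v : V) :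
    chainSection ρ hp Y hY π hπ v = (Fintype.card (blockSubgroup G Y) : K)⁻¹ •
      ∑ g : blockSubgroup G Y,
        (MonoidAlgebra.of K (GPartitionMonoid n G) (mkGPartition π hπ g) *
          prodOneSub K (notAbove Y)) ⊗ₜ[K] (chainRep ρ hp).asModuleEquiv.symm
            (Finsupp.single (orderingChain hY)
              (ρ (Subgroup.inclusion (blockSubgroup_anti (hp Y hY)) g⁻¹) v)) := by
  simp [chainSection]

theorem chainSection_congr {Y Y' : Finpartition (Finset.univ : Finset (Fin n))} (h : Y = Y')
    (hY : p Y) (hY' : p Y') (π : OrderedSetPartition n) (hπ : π.toFinpartition = Y)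
    (hπ' : π.toFinpartition = Y') :
    chainSection ρ hp Y hY π hπ = chainSection ρ hp Y' hY' π hπ' := by
  subst h
  rfl

/-- Multiplication by `m` turns `(π, g)` into `(m π, h g)`; reindexing the average by `h` moves `h`
onto the coefficient. The partition `Y` is a separate argument because it is shared by `π` and `m
π`. -/
theorem chainSection_smul_of_le (Y : Finpartition (Finset.univ : Finset (Fin n))) (hY : p Y)
    (π : OrderedSetPartition n) (hπ : π.toFinpartition = Y) (m : GPartitionMonoid n G)
    (hmπ : (m.1.1 * π).toFinpartition = Y) (h : blockSubgroup G Y)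
    (hh : h.1 = m.1.2) (v : V) :
    MonoidAlgebra.of K (GPartitionMonoid n G) m • chainSection ρ hp Y hY π hπ v =
      chainSection ρ hp Y hY (m.1.1 * π) hmπ
        (ρ (Subgroup.inclusion (blockSubgroup_anti (hp Y hY)) h) v) := by
  rw [chainSection_apply, chainSection_apply, smul_comm, Finset.smul_sum]
  congr 1
  refine Fintype.sum_equiv (Equiv.mulLeft h) _ _ fun g => ?_
  rw [TensorProduct.smul_tmul', smul_eq_mul, ← mul_assoc, ← map_mul]
  have e1 : m * mkGPartition π hπ g = mkGPartition (m.1.1 * π) hmπ (h * g) := by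
    ext1
    refine Prod.ext rfl ?_
    change m.1.2 * g.1 = h.1 * g.1
    rw [hh]
  rw [e1, Equiv.coe_mulLeft, mul_inv_rev, ← Module.End.mul_apply, ← map_mul, ← map_mul,
    inv_mul_cancel_right]

/-- The support of each `m (π, g)` is at most `supp m`, hence not above `Y`, so `prodOneSub K
(notAbove Y)` annihilates it. -/
theorem chainSection_smul_of_not_le (Y : Finpartition (Finset.univ : Finset (Fin n))) (hY : p Y)
    (π : OrderedSetPartition n) (hπ : π.toFinpartition = Y) (m : GPartitionMonoid n G)
    (hm : ¬ Y ≤ supp m) (v : V) :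
    MonoidAlgebra.of K (GPartitionMonoid n G) m • chainSection ρ hp Y hY π hπ v = 0 := by
  rw [chainSection_apply, smul_comm, Finset.smul_sum, Finset.sum_eq_zero, smul_zero]
  intro g _
  rw [TensorProduct.smul_tmul', smul_eq_mul, ← mul_assoc, ← map_mul, of_mul_prodOneSub_notAbove K,
    TensorProduct.zero_tmul]
  exact fun h => hm (h.trans (supp_mul_le_left _ _))

/-- All summands of the average have the same image: the product of the `1 - m` fixes the chosen
ordering of `Y`, the element `(π, g)` carries that ordering to `π`, and `g` cancels `g⁻¹` on the
coefficient. -/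
theorem lift_chainSection (Y : Finpartition (Finset.univ : Finset (Fin n))) (hY : p Y)
    (hc : (Fintype.card (blockSubgroup G Y) : K) ≠ 0)
    (π : {π : OrderedSetPartition n // p π.toFinpartition}) (hπ : π.1.toFinpartition = Y) (v : V) :
    TensorProduct.AlgebraTensorModule.lift (LinearMap.toSpanSingleton K[GPartitionMonoid n G]
        ((chainRep ρ hp).asModule →ₗ[K] (chainRep ρ hp).asModule) LinearMap.id)
      (chainSection ρ hp Y hY π.1 hπ v) = (chainRep ρ hp).asModuleEquiv.symm
        (Finsupp.single π v) := by
  rw [chainSection_apply, LinearMap.map_smul_of_tower, map_sum]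
  have key : ∀ g : blockSubgroup G Y,
      TensorProduct.AlgebraTensorModule.lift (LinearMap.toSpanSingleton K[GPartitionMonoid n G]
        ((chainRep ρ hp).asModule →ₗ[K] (chainRep ρ hp).asModule) LinearMap.id)
      ((MonoidAlgebra.of K (GPartitionMonoid n G) (mkGPartition π.1 hπ g) *
          prodOneSub K (notAbove Y)) ⊗ₜ[K] (chainRep ρ hp).asModuleEquiv.symm
            (Finsupp.single (orderingChain hY)
              (ρ (Subgroup.inclusion (blockSubgroup_anti (hp Y hY)) g⁻¹) v))) =
      (chainRep ρ hp).asModuleEquiv.symm (Finsupp.single π v) := by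
    intro g
    have h0 : ∀ μ ∈ notAbove Y, MonoidAlgebra.of K (GPartitionMonoid n G) (inlHom n G μ) •
        (chainRep ρ hp).asModuleEquiv.symm (Finsupp.single (orderingChain hY)
          (ρ (Subgroup.inclusion (blockSubgroup_anti (hp Y hY)) g⁻¹) v)) = 0 := fun μ hμ => by
      rw [ofFn_smul]
      refine chainMap_single_of_not_le ρ hp (fun h => not_le_of_mem_notAbove hμ ?_) _
      exact (toFinpartition_ordering Y).ge.trans h
    rw [TensorProduct.AlgebraTensorModule.lift_tmul, LinearMap.toSpanSingleton_apply,
      LinearMap.smul_apply, LinearMap.id_apply, mul_smul]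
    refine (congrArg _ (prodOneSub_smul K h0)).trans ?_
    rw [ofFn_smul]
    have h1 : (orderingChain hY).1.toFinpartition ≤ supp (mkGPartition π.1 hπ g) :=
      (toFinpartition_ordering Y).le.trans hπ.ge
    have h2 : π.1 = (mkGPartition π.1 hπ g).1.1 * (orderingChain hY).1 :=
      (mul_eq_left (hπ.le.trans (toFinpartition_ordering Y).ge)).symm
    have h3 : (Subgroup.inclusion (blockSubgroup_anti (hp Y hY)) g).1 =
      (mkGPartition π.1 hπ g).1.2 := rfl
    refine (chainMap_single_of_le ρ hp h1 h2 h3 _).trans ?_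
    rw [← Module.End.mul_apply, ← map_mul, ← map_mul, mul_inv_cancel, map_one, map_one]
    rfl
  rw [Finset.sum_congr rfl fun g _ => key g, Finset.sum_const, Finset.card_univ,
    ← Nat.cast_smul_eq_nsmul K, smul_smul, inv_mul_cancel₀ hc, one_smul]

/-- The sections assemble to a splitting, linear over the monoid algebra, of the multiplication map
from `K[M] ⊗ C` to the chain module `C`; its source is free because `K` is a field. -/
theorem projective_chainRep
    (hc : ∀ Y : Finpartition (Finset.univ : Finset (Fin n)),
      (Fintype.card (blockSubgroup G Y) : K) ≠ 0) :
    Module.Projective K[GPartitionMonoid n G] (chainRep ρ hp).asModule := by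
  let i : (chainRep ρ hp).asModule →ₗ[K]
      K[GPartitionMonoid n G] ⊗[K] (chainRep ρ hp).asModule :=
    (Finsupp.lsum K fun π : {π : OrderedSetPartition n // p π.toFinpartition} =>
      chainSection ρ hp _ π.2 π.1 rfl) ∘ₗ (chainRep ρ hp).asModuleEquiv.toLinearMap
  have hi (π : {π : OrderedSetPartition n // p π.toFinpartition}) (v : V) :
      i ((chainRep ρ hp).asModuleEquiv.symm (Finsupp.single π v)) =
        chainSection ρ hp _ π.2 π.1 rfl v := by
    simp [i]
  have hcomm : ∀ (m : GPartitionMonoid n G) (x : (chainRep ρ hp).asModule),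
      i (MonoidAlgebra.single m (1 : K) • x) = MonoidAlgebra.single m (1 : K) • i x := by
    intro m x
    obtain ⟨x, rfl⟩ := (chainRep ρ hp).asModuleEquiv.symm.surjective x
    rw [← MonoidAlgebra.of_apply, ofFn_smul]
    induction x using Finsupp.induction_linear with
    | zero =>
      refine (congrArg i (map_zero (chainMap ρ hp m))).trans ((map_zero i).trans ?_)
      rw [map_zero, map_zero, smul_zero]
    | add x y hx hy =>
      refine (congrArg i (map_add (chainMap ρ hp m) x y)).trans ((map_add i _ _).trans ?_)
      refine (congrArg₂ _ hx hy).trans ?_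
      rw [← smul_add, ← map_add, ← map_add]
    | single π v =>
      by_cases h : π.1.toFinpartition ≤ supp m
      · have hmπ := toFinpartition_mul_of_le h
        let g : blockSubgroup G π.1.toFinpartition :=
          ⟨m.1.2, blockSubgroup_anti h (snd_mem_blockSubgroup m)⟩
        let π' : {π : OrderedSetPartition n // p π.toFinpartition} :=
          ⟨m.1.1 * π.1, hmπ.symm ▸ π.2⟩
        have e1 := chainMap_single_of_le ρ hp (m := m) (π := π) (π' := π') h rfl
          (g := Subgroup.inclusion (blockSubgroup_anti (hp _ π.2)) g) rfl v
        rw [hi, chainSection_smul_of_le ρ hp _ π.2 π.1 rfl m hmπ g rfl v]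
        refine (congrArg i e1).trans ((hi π' _).trans ?_)
        rw [chainSection_congr ρ hp hmπ π'.2 π.2 π'.1 rfl hmπ]
      · rw [hi, chainSection_smul_of_not_le ρ hp _ π.2 π.1 rfl m h v]
        exact (congrArg i (chainMap_single_of_not_le ρ hp h v)).trans (map_zero i)
  refine Module.Projective.of_split (MonoidAlgebra.equivariantOfLinearOfComm i hcomm)
    (TensorProduct.AlgebraTensorModule.lift (LinearMap.toSpanSingleton K[GPartitionMonoid n G]
      ((chainRep ρ hp).asModule →ₗ[K] (chainRep ρ hp).asModule) LinearMap.id)) ?_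
  refine LinearMap.ext fun x => ?_
  rw [LinearMap.comp_apply, MonoidAlgebra.equivariantOfLinearOfComm_apply, LinearMap.id_apply]
  obtain ⟨x, rfl⟩ := (chainRep ρ hp).asModuleEquiv.symm.surjective x
  induction x using Finsupp.induction_linear with
  | zero => simp
  | add x y hx hy => rw [map_add, map_add, map_add, hx, hy]
  | single π v => rw [hi, lift_chainSection ρ hp _ π.2 (hc _) π rfl v]

end Projective

/-! ### Morphisms from chain modules to inflated representations -/

section Hom

variable {Y : Finpartition (Finset.univ : Finset (Fin n))} {W : Type*} [AddCommGroup W]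
  [Module K W] {σ : Representation K (blockSubgroup G Y) W}

theorem inflateRep_of_le {m : GPartitionMonoid n G} (h : Y ≤ supp m) {g : blockSubgroup G Y}
    (hg : g.1 = m.1.2) : inflateRep Y σ m = σ g := by
  obtain rfl : g = ⟨m.1.2, blockSubgroup_anti h (snd_mem_blockSubgroup m)⟩ := Subtype.ext hg
  exact dif_pos h

theorem inflateRep_of_not_le {m : GPartitionMonoid n G} (h : ¬ Y ≤ supp m) :
    inflateRep Y σ m = 0 :=
  dif_neg h

variable {ρ hp} (φ : IntertwiningMap (chainRep ρ hp) (inflateRep Y σ))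

/-- The element `ordering Y` acts as the identity on the target, while `ordering Y * π = ordering Y`
by `mul_eq_left`. -/
theorem intertwiningMap_single_mul (π : {π : OrderedSetPartition n // p π.toFinpartition}) (v : V)
    (hπ : π.1.toFinpartition = Y) (hY : p Y) :
    φ (Finsupp.single π v) = φ (Finsupp.single (orderingChain hY) v) := by
  have h : π.1.toFinpartition ≤ supp (inlHom n G (ordering Y)) :=
    hπ.le.trans (toFinpartition_ordering Y).ge
  have e1 := chainMap_single_of_le ρ hp (π' := orderingChain hY) h
    (mul_eq_left ((toFinpartition_ordering Y).le.trans hπ.ge)).symm (g := 1) rfl v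
  have e2 := IntertwiningMap.isIntertwining _ _ φ (inlHom n G (ordering Y)) (Finsupp.single π v)
  rw [chainRep_apply, e1, inflateRep_of_le (hπ.ge.trans h) (g := 1) rfl, map_one, map_one] at e2
  exact e2.symm

/-- If `Y < σ(π)`, then `ordering Y` kills the chain but is the identity on the target. If `Y` is
not below `σ(π)`, then `π` fixes the chain but kills the target. -/
theorem intertwiningMap_single_eq_zero (π : {π : OrderedSetPartition n // p π.toFinpartition})
    (v : V) (hπ : π.1.toFinpartition ≠ Y) : φ (Finsupp.single π v) = 0 := by
  by_cases h : Y ≤ π.1.toFinpartition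
  · have h' : ¬ π.1.toFinpartition ≤ supp (inlHom n G (ordering Y)) := fun h' =>
      hπ (le_antisymm (h'.trans (toFinpartition_ordering Y).le) h)
    have e2 := IntertwiningMap.isIntertwining _ _ φ (inlHom n G (ordering Y)) (Finsupp.single π v)
    rw [chainRep_apply, chainMap_single_of_not_le ρ hp h', map_zero,
      inflateRep_of_le (toFinpartition_ordering Y).ge (g := 1) rfl, map_one] at e2
    exact e2.symm
  · have e2 := IntertwiningMap.isIntertwining _ _ φ (inlHom n G π.1) (Finsupp.single π v)
    have e1 := chainMap_single_of_le ρ hp (π := π) (π' := π) (m := inlHom n G π.1) le_rfl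
      (mul_eq_left le_rfl).symm (g := 1) rfl v
    rw [chainRep_apply, e1, inflateRep_of_not_le h, map_one] at e2
    exact e2

variable (ρ hp σ) in
theorem subsingleton_intertwiningMap_chainRep (hY : ¬ p Y) :
    Subsingleton (IntertwiningMap (chainRep ρ hp) (inflateRep Y σ)) := by
  refine subsingleton_of_forall_eq 0 fun φ => ?_
  ext1
  refine Finsupp.lhom_ext fun π v => ?_
  exact intertwiningMap_single_eq_zero φ π v fun h => hY (h ▸ π.2)

variable (ρ hp σ) in
open Classical in
/-- Morphisms from the chains on ordered set partitions to an inflated representation. -/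
noncomputable def chainRepHomEquiv (hY : p Y) :
    IntertwiningMap (chainRep ρ hp) (inflateRep Y σ) ≃ₗ[K]
      IntertwiningMap (ρ.comp (Subgroup.inclusion (blockSubgroup_anti (hp Y hY)))) σ where
  toFun φ :=
    { toLinearMap := φ.toLinearMap ∘ₗ Finsupp.lsingle (orderingChain hY)
      isIntertwining' := fun g => by
        refine LinearMap.ext fun v => ?_
        let m := mkGPartition (ordering Y) (toFinpartition_ordering Y) g
        have h : (orderingChain hY).1.toFinpartition ≤ supp m := le_rfl
        have e1 := chainMap_single_of_le ρ hp (m := m) h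
          (π' := orderingChain hY) (mul_eq_left (le_refl (ordering Y).toFinpartition)).symm
          (g := Subgroup.inclusion (blockSubgroup_anti (hp Y hY)) g) rfl v
        have e2 := IntertwiningMap.isIntertwining _ _ φ m (Finsupp.single (orderingChain hY) v)
        rw [chainRep_apply, e1,
          inflateRep_of_le ((toFinpartition_ordering Y).ge.trans h) (g := g) rfl] at e2
        exact e2 }
  map_add' _ _ := rfl
  map_smul' _ _ := rfl
  invFun ψ :=
    { toLinearMap := Finsupp.lsum K fun π =>
        if π.1.toFinpartition = Y then ψ.toLinearMap else 0
      isIntertwining' := fun m => by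
        refine Finsupp.lhom_ext fun π v => ?_
        simp only [LinearMap.comp_apply, chainRep_apply]
        by_cases h : π.1.toFinpartition ≤ supp m
        · have hmπ := toFinpartition_mul_of_le h
          let g : blockSubgroup G π.1.toFinpartition :=
            ⟨m.1.2, blockSubgroup_anti h (snd_mem_blockSubgroup m)⟩
          let π' : {π : OrderedSetPartition n // p π.toFinpartition} :=
            ⟨m.1.1 * π.1, hmπ.symm ▸ π.2⟩
          rw [chainMap_single_of_le ρ hp (m := m) (π := π) (π' := π') h rfl
            (g := Subgroup.inclusion (blockSubgroup_anti (hp _ π.2)) g) rfl v,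
            Finsupp.lsum_single, Finsupp.lsum_single]
          by_cases hπ : π.1.toFinpartition = Y
          · rw [if_pos hπ, if_pos (hmπ.trans hπ)]
            have hY' : Y ≤ supp m := hπ.ge.trans h
            rw [inflateRep_of_le hY'
              (g := ⟨m.1.2, blockSubgroup_anti hY' (snd_mem_blockSubgroup m)⟩) rfl]
            exact IntertwiningMap.isIntertwining _ _ ψ
              ⟨m.1.2, blockSubgroup_anti hY' (snd_mem_blockSubgroup m)⟩ v
          · rw [if_neg hπ, if_neg fun h => hπ (hmπ.symm.trans h)]
            simp
        · rw [chainMap_single_of_not_le ρ hp h, map_zero, Finsupp.lsum_single]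
          by_cases hπ : π.1.toFinpartition = Y
          · rw [inflateRep_of_not_le fun h' => h (hπ.le.trans h')]
            rfl
          · rw [if_neg hπ]
            simp }
  left_inv φ := by
    ext1
    refine Finsupp.lhom_ext fun π v => ?_
    refine (Finsupp.lsum_single ..).trans ?_
    by_cases hπ : π.1.toFinpartition = Y
    · rw [if_pos hπ]
      exact (intertwiningMap_single_mul φ π v hπ hY).symm
    · rw [if_neg hπ]
      exact (intertwiningMap_single_eq_zero φ π v hπ).symm
  right_inv ψ := by
    ext1
    refine LinearMap.ext fun v => ?_
    change (Finsupp.lsum K fun π : {π : OrderedSetPartition n // p π.toFinpartition} =>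
      if π.1.toFinpartition = Y then ψ.toLinearMap else 0)
        (Finsupp.single (orderingChain hY) v) = _
    rw [Finsupp.lsum_single]
    exact congrArg (fun f : V →ₗ[K] W => f v) (if_pos (toFinpartition_ordering Y))

end Hom

/-! ### Saturated sets and their splittings -/

section Splits

variable {n : ℕ} (X : Finpartition (Finset.univ : Finset (Fin n)))

/-- A set is saturated if it is a union of blocks of the set partition `X`. -/
def Saturated (A : Finset (Fin n)) : Prop :=
  ∀ B ∈ X.parts, ∀ i ∈ B, i ∈ A → B ⊆ A

variable {X} {A B C P : Finset (Fin n)}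

theorem Saturated.sdiff (hA : Saturated X A) (hC : Saturated X C) : Saturated X (A \ C) := by
  intro B hB i hi hiA j hj
  rw [Finset.mem_sdiff] at hiA ⊢
  exact ⟨hA B hB i hi hiA.1 hj, fun h => hiA.2 (hC B hB j hj h hi)⟩

theorem Saturated.union (hA : Saturated X A) (hC : Saturated X C) : Saturated X (A ∪ C) := by
  intro B hB i hi hiA j hj
  rw [Finset.mem_union] at hiA ⊢
  exact hiA.imp (fun h => hA B hB i hi h hj) fun h => hC B hB i hi h hj

theorem saturated_of_mem (hB : B ∈ X.parts) : Saturated X B := by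
  intro B' hB' i hi hi'
  rw [X.eq_of_mem_parts hB' hB hi hi']

theorem Saturated.disjoint_of_not_subset (hA : Saturated X A) (hB : B ∈ X.parts) (h : ¬ B ⊆ A) :
    Disjoint B A :=
  Finset.disjoint_left.mpr fun i hi hi' => h (hA B hB i hi hi')

variable (X) in
open Classical in
/-- The non-empty proper saturated subsets of a set. -/
noncomputable def splits (P : Finset (Fin n)) : Finset (Finset (Fin n)) :=
  P.powerset.filter fun A => A.Nonempty ∧ A ≠ P ∧ Saturated X A

theorem mem_splits : A ∈ splits X P ↔ A ⊆ P ∧ A.Nonempty ∧ A ≠ P ∧ Saturated X A := by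
  simp [splits]

theorem sdiff_mem_splits (hP : Saturated X P) (hA : A ∈ splits X P) : P \ A ∈ splits X P := by
  obtain ⟨h1, h2, h3, h4⟩ := mem_splits.mp hA
  refine mem_splits.mpr ⟨Finset.sdiff_subset, ?_, fun h => ?_, hP.sdiff h4⟩
  · exact Finset.sdiff_nonempty.mpr fun h => h3 (h1.antisymm h)
  · rw [Finset.sdiff_eq_self_iff_disjoint] at h
    obtain ⟨i, hi⟩ := h2
    exact Finset.disjoint_left.mp h (h1 hi) hi

theorem splits_of_mem (hB : B ∈ X.parts) : splits X B = ∅ := by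
  refine Finset.eq_empty_of_forall_notMem fun A hA => ?_
  obtain ⟨h1, ⟨i, hi⟩, h3, h4⟩ := mem_splits.mp hA
  exact h3 (h1.antisymm (h4 B hB i (h1 hi) hi))

/-- A saturated subset of `C ∪ B` contains the block `B` or misses it. -/
theorem sum_splits_union {M : Type*} [AddCommMonoid M] (hB : B ∈ X.parts) (hC : Saturated X C)
    (hC0 : C.Nonempty) (hBC : Disjoint B C) (f : Finset (Fin n) → M) :
    ∑ A ∈ splits X (C ∪ B), f A = f B + f C + ∑ A ∈ splits X C, (f (A ∪ B) + f A) := by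
  classical
  obtain ⟨b, hb⟩ := X.nonempty_of_mem_parts hB
  obtain ⟨c, hc⟩ := hC0
  have hbC : b ∉ C := Finset.disjoint_left.mp hBC hb
  have hcB : c ∉ B := Finset.disjoint_right.mp hBC hc
  have hinj : Set.InjOn (fun A => A ∪ B) (splits X C : Set (Finset (Fin n))) := by
    intro A hA A' hA' h
    have hd {A} (hA : A ∈ splits X C) : (A ∪ B) \ B = A := by
      rw [Finset.union_sdiff_right, Finset.sdiff_eq_self_iff_disjoint]
      exact (hBC.mono_right (mem_splits.mp hA).1).symm
    rw [← hd hA, ← hd hA']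
    exact congrArg (· \ B) h
  have key : splits X (C ∪ B) =
      insert B (insert C ((splits X C).image (fun A => A ∪ B) ∪ splits X C)) := by
    ext A
    simp only [Finset.mem_insert, Finset.mem_union, Finset.mem_image]
    constructor
    · intro hA
      obtain ⟨h1, h2, h3, h4⟩ := mem_splits.mp hA
      by_cases hBA : B ⊆ A
      · have hA' : A \ B ∪ B = A := Finset.sdiff_union_of_subset hBA
        rcases (A \ B).eq_empty_or_nonempty with h0 | h0
        · left
          rw [← hA', h0, Finset.empty_union]
        · right; right; left
          refine ⟨A \ B, mem_splits.mpr ⟨?_, h0, fun h => h3 ?_, h4.sdiff (saturated_of_mem hB)⟩,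
            hA'⟩
          · refine sdiff_le_iff.mpr ?_
            rw [Finset.sup_eq_union, Finset.union_comm]
            exact h1
          · rw [← hA', h]
      · have hd := h4.disjoint_of_not_subset hB hBA
        have hAC : A ⊆ C := hd.symm.left_le_of_le_sup_right h1
        by_cases h : A = C
        · exact Or.inr (Or.inl h)
        · exact Or.inr (Or.inr (Or.inr (mem_splits.mpr ⟨hAC, h2, h, h4⟩)))
    · rintro (rfl | rfl | ⟨A, hA, rfl⟩ | hA)
      · exact mem_splits.mpr ⟨Finset.subset_union_right, ⟨b, hb⟩,
          fun h => hcB (h ▸ Finset.mem_union_left _ hc), saturated_of_mem hB⟩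
      · exact mem_splits.mpr ⟨Finset.subset_union_left, ⟨c, hc⟩,
          fun h => hbC (h ▸ Finset.mem_union_right _ hb), hC⟩
      · obtain ⟨h1, h2, h3, h4⟩ := mem_splits.mp hA
        refine mem_splits.mpr ⟨Finset.union_subset_union_left h1, h2.mono Finset.subset_union_left,
          fun h => h3 (h1.antisymm fun i hi => ?_), h4.union (saturated_of_mem hB)⟩
        exact (Finset.mem_union.mp (h ▸ Finset.mem_union_left _ hi : i ∈ A ∪ B)).resolve_right
          (Finset.disjoint_right.mp hBC hi)
      · obtain ⟨h1, h2, h3, h4⟩ := mem_splits.mp hA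
        exact mem_splits.mpr ⟨h1.trans Finset.subset_union_left, h2,
          fun h => hbC (h1 (h ▸ Finset.mem_union_right _ hb)), h4⟩
  rw [key, Finset.sum_insert, Finset.sum_insert, Finset.sum_union, Finset.sum_image hinj,
    Finset.sum_add_distrib, add_assoc]
  · rw [Finset.disjoint_left]
    rintro A hA hA'
    obtain ⟨A, -, rfl⟩ := Finset.mem_image.mp hA
    exact hbC ((mem_splits.mp hA').1 (Finset.mem_union_right _ hb))
  · simp only [Finset.mem_union, Finset.mem_image, not_or]
    refine ⟨?_, fun h => (mem_splits.mp h).2.2.1 rfl⟩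
    rintro ⟨A, -, rfl⟩
    exact hbC (Finset.mem_union_right _ hb)
  · simp only [Finset.mem_insert, Finset.mem_union, Finset.mem_image, not_or]
    refine ⟨fun h => hbC (h ▸ hb), ?_, fun h => hbC ((mem_splits.mp h).1 hb)⟩
    rintro ⟨A, hA, h⟩
    obtain ⟨h1, ⟨i, hi⟩, -, -⟩ := mem_splits.mp hA
    exact Finset.disjoint_right.mp hBC (h1 hi) (h ▸ Finset.mem_union_left _ hi)

/-- Both sides run over the ordered decompositions of `P` into three non-empty saturated parts. -/
theorem sum_splits_splits {M : Type*} [AddCommMonoid M] (P : Finset (Fin n))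
    (f : Finset (Fin n) → Finset (Fin n) → Finset (Fin n) → M) :
    ∑ A ∈ splits X P, ∑ A' ∈ splits X A, f A' (A \ A') (P \ A) =
      ∑ A ∈ splits X P, ∑ A' ∈ splits X (P \ A), f A A' ((P \ A) \ A') := by
  rw [Finset.sum_sigma', Finset.sum_sigma']
  refine Finset.sum_bij' (fun x _ => ⟨x.2, x.1 \ x.2⟩) (fun x _ => ⟨x.1 ∪ x.2, x.1⟩) ?_ ?_ ?_ ?_ ?_
  · rintro ⟨A, A'⟩ h
    obtain ⟨h, h'⟩ := Finset.mem_sigma.mp h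
    obtain ⟨h1, ⟨i, hi⟩, h3, h4⟩ := mem_splits.mp h
    obtain ⟨h1', h2', h3', h4'⟩ := mem_splits.mp h'
    refine Finset.mem_sigma.mpr ⟨mem_splits.mpr ⟨h1'.trans h1, h2', ?_, h4'⟩,
      mem_splits.mpr ⟨Finset.sdiff_subset_sdiff h1 le_rfl, ?_,
        fun (h : A \ A' = P \ A') => h3 (h1.antisymm ?_), h4.sdiff h4'⟩⟩
    · rintro rfl
      exact h3 (h1.antisymm h1')
    · exact Finset.sdiff_nonempty.mpr fun h => h3' (h1'.antisymm h)
    · intro j hj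
      by_cases hj' : j ∈ A'
      · exact h1' hj'
      · exact (Finset.mem_sdiff.mp (h ▸ Finset.mem_sdiff.mpr ⟨hj, hj'⟩ : j ∈ A \ A')).1
  · rintro ⟨A, A'⟩ h
    obtain ⟨h, h'⟩ := Finset.mem_sigma.mp h
    obtain ⟨h1, h2, h3, h4⟩ := mem_splits.mp h
    obtain ⟨h1', ⟨i, hi⟩, h3', h4'⟩ := mem_splits.mp h'
    refine Finset.mem_sigma.mpr ⟨mem_splits.mpr ⟨Finset.union_subset h1
      (h1'.trans Finset.sdiff_subset), h2.mono Finset.subset_union_left,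
      fun (h : A ∪ A' = P) => h3' (h1'.antisymm ?_), h4.union h4'⟩,
      mem_splits.mpr ⟨Finset.subset_union_left, h2, fun (h : A = A ∪ A') => ?_, h4⟩⟩
    · intro j hj
      obtain ⟨hj1, hj2⟩ := Finset.mem_sdiff.mp hj
      exact (Finset.mem_union.mp (h ▸ hj1 : j ∈ A ∪ A')).resolve_left hj2
    · exact (Finset.mem_sdiff.mp (h1' hi)).2 (h ▸ Finset.mem_union_right _ hi)
  · rintro ⟨A, A'⟩ h
    obtain ⟨h, h'⟩ := Finset.mem_sigma.mp h
    simp only [Finset.union_sdiff_of_subset (mem_splits.mp h').1]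
  · rintro ⟨A, A'⟩ h
    obtain ⟨h, h'⟩ := Finset.mem_sigma.mp h
    have hd : Disjoint A A' :=
      Finset.disjoint_of_subset_right (mem_splits.mp h').1 Finset.disjoint_sdiff
    simp only [Finset.union_sdiff_cancel_left hd]
  · rintro ⟨A, A'⟩ h
    obtain ⟨h, h'⟩ := Finset.mem_sigma.mp h
    have : (P \ A') \ (A \ A') = P \ A := by
      rw [sdiff_sdiff_left, Finset.sup_eq_union, Finset.union_sdiff_of_subset (mem_splits.mp h').1]
    simp only [this]

end Splits

/-! ### The boundary on lists and the contracting homotopy -/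

section Operators

variable (K : Type u) [Field K] {n : ℕ} (V : Type w) [AddCommGroup V] [Module K V]

/-- Chains on lists of subsets, with coefficients in `V`. -/
abbrev ListChain (n : ℕ) (V : Type w) [AddCommGroup V] := List (Finset (Fin n)) →₀ V

/-- Prepend a set to each list. -/
noncomputable def consL (P : Finset (Fin n)) : ListChain n V →ₗ[K] ListChain n V :=
  Finsupp.lmapDomain V K (List.cons P)

/-- Append a set to each list. -/
noncomputable def appL (P : Finset (Fin n)) : ListChain n V →ₗ[K] ListChain n V :=
  Finsupp.lmapDomain V K fun L => L ++ [P]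

variable {K V}

theorem consL_single (P : Finset (Fin n)) (L : List (Finset (Fin n))) (v : V) :
    consL K V P (Finsupp.single L v) = Finsupp.single (P :: L) v :=
  Finsupp.mapDomain_single

theorem appL_single (P : Finset (Fin n)) (L : List (Finset (Fin n))) (v : V) :
    appL K V P (Finsupp.single L v) = Finsupp.single (L ++ [P]) v :=
  Finsupp.mapDomain_single

theorem appL_injective (P : Finset (Fin n)) : Function.Injective (appL K V P) :=
  Finsupp.mapDomain_injective fun _ _ h => List.append_cancel_right h

theorem appL_consL (B P : Finset (Fin n)) (z : ListChain n V) :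
    appL K V B (consL K V P z) = consL K V P (appL K V B z) := by
  induction z using Finsupp.induction_linear with
  | zero => simp
  | add x y hx hy => simp only [map_add, hx, hy]
  | single L v => simp only [consL_single, appL_single, List.cons_append]

variable (K V) (X : Finpartition (Finset.univ : Finset (Fin n)))

/-- The boundary of a list of sets: the alternating sum of the lists obtained by splitting one
of the sets into two saturated parts. -/
noncomputable def bdList : List (Finset (Fin n)) → V →ₗ[K] ListChain n V
  | [] => 0
  | P :: L => ∑ A ∈ splits X P, Finsupp.lsingle (A :: (P \ A) :: L) - consL K V P ∘ₗ bdList L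

/-- The boundary on chains of lists of sets. -/
noncomputable def bd : ListChain n V →ₗ[K] ListChain n V :=
  Finsupp.lsum K (bdList K V X)

variable {K V}

theorem bd_nil (v : V) : bd K V X (Finsupp.single [] v) = 0 := by
  rw [bd, Finsupp.lsum_single]
  rfl

theorem bd_consL (P : Finset (Fin n)) (z : ListChain n V) :
    bd K V X (consL K V P z) =
      ∑ A ∈ splits X P, consL K V A (consL K V (P \ A) z) - consL K V P (bd K V X z) := by
  induction z using Finsupp.induction_linear with
  | zero => simp
  | add x y hx hy =>
    simp only [map_add, hx, hy, Finset.sum_add_distrib]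
    abel
  | single L v =>
    rw [bd, consL_single, Finsupp.lsum_single, Finsupp.lsum_single]
    simp [bdList, consL_single]

/-- After a splitting of the first set, either part can be split again; the two kinds of terms have
opposite signs and match by `sum_splits_splits`. Splitting the first set and splitting the tail
anticommute. -/
theorem bd_bd (z : ListChain n V) : bd K V X (bd K V X z) = 0 := by
  induction z using Finsupp.induction_linear with
  | zero => simp
  | add x y hx hy => simp only [map_add, hx, hy, add_zero]
  | single L v =>
    induction L with
    | nil => rw [bd_nil, map_zero]
    | cons P L ih =>
      rw [← consL_single (K := K)]
      generalize Finsupp.single L v = z at ih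
      rw [bd_consL, map_sub, map_sum, bd_consL, ih]
      simp only [bd_consL, map_sub, map_sum, Finset.sum_sub_distrib]
      rw [sum_splits_splits P fun A B C => consL K V A (consL K V B (consL K V C z))]
      simp

/-- A single block of `X` cannot be split, so at the end of a list it contributes nothing. -/
theorem bd_appL {B : Finset (Fin n)} (hB : B ∈ X.parts) (z : ListChain n V) :
    bd K V X (appL K V B z) = appL K V B (bd K V X z) := by
  induction z using Finsupp.induction_linear with
  | zero => simp
  | add x y hx hy => simp only [map_add, hx, hy]
  | single L v =>
    induction L with
    | nil =>
      rw [appL_single, bd_nil, map_zero, List.nil_append, ← consL_single (K := K), bd_consL, bd_nil,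
        splits_of_mem hB]
      simp
    | cons P L ih =>
      rw [← consL_single (K := K)]
      generalize Finsupp.single L v = z at ih
      rw [bd_consL, appL_consL, bd_consL, ih, map_sub, map_sum, appL_consL]
      simp only [appL_consL]

variable (K V) (B : Finset (Fin n))

/-- Insert a block in each of the members of a list in turn. -/
noncomputable def insList : List (Finset (Fin n)) → V →ₗ[K] ListChain n V
  | [] => 0
  | P :: L => Finsupp.lsingle ((P ∪ B) :: L) + consL K V P ∘ₗ insList L

/-- The linear extension of `insList`. -/
noncomputable def ins : ListChain n V →ₗ[K] ListChain n V :=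
  Finsupp.lsum K (insList K V B)

open Classical in
/-- Remove a singleton block from a list and insert it in each of the later members in turn. -/
noncomputable def homotopyList : List (Finset (Fin n)) → V →ₗ[K] ListChain n V
  | [] => 0
  | P :: L => if P = B then insList K V B L else if B ⊆ P then 0
    else - (consL K V P ∘ₗ homotopyList L)

/-- The linear extension of `homotopyList`. -/
noncomputable def homotopy : ListChain n V →ₗ[K] ListChain n V :=
  Finsupp.lsum K (homotopyList K V B)

open Classical in
/-- Remove a singleton block from a list, with a sign. -/
noncomputable def removeList : List (Finset (Fin n)) → V →ₗ[K] ListChain n V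
  | [] => 0
  | P :: L => if P = B then (-1 : ℤˣ) ^ L.length • Finsupp.lsingle L else if B ⊆ P then 0
    else consL K V P ∘ₗ removeList L

/-- The linear extension of `removeList`. -/
noncomputable def remove : ListChain n V →ₗ[K] ListChain n V :=
  Finsupp.lsum K (removeList K V B)

variable {K V}

theorem ins_nil (v : V) : ins K V B (Finsupp.single [] v) = 0 := by
  rw [ins, Finsupp.lsum_single]
  rfl

theorem ins_consL (P : Finset (Fin n)) (z : ListChain n V) :
    ins K V B (consL K V P z) = consL K V (P ∪ B) z + consL K V P (ins K V B z) := by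
  induction z using Finsupp.induction_linear with
  | zero => simp
  | add x y hx hy =>
    simp only [map_add, hx, hy]
    abel
  | single L v =>
    rw [ins, consL_single, Finsupp.lsum_single, Finsupp.lsum_single]
    simp [insList, consL_single]

theorem homotopy_consL_self (z : ListChain n V) :
    homotopy K V B (consL K V B z) = ins K V B z := by
  induction z using Finsupp.induction_linear with
  | zero => simp
  | add x y hx hy => simp only [map_add, hx, hy]
  | single L v =>
    rw [homotopy, consL_single, Finsupp.lsum_single, ins, Finsupp.lsum_single, homotopyList,
      if_pos rfl]

variable {B} {P : Finset (Fin n)}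

theorem homotopy_consL_of_subset (h : B ⊆ P) (h' : P ≠ B) (z : ListChain n V) :
    homotopy K V B (consL K V P z) = 0 := by
  induction z using Finsupp.induction_linear with
  | zero => simp
  | add x y hx hy => simp only [map_add, hx, hy, add_zero]
  | single L v =>
    rw [homotopy, consL_single, Finsupp.lsum_single, homotopyList, if_neg h', if_pos h]
    rfl

theorem homotopy_consL_of_not_subset (h : ¬ B ⊆ P) (z : ListChain n V) :
    homotopy K V B (consL K V P z) = - consL K V P (homotopy K V B z) := by
  induction z using Finsupp.induction_linear with
  | zero => simp
  | add x y hx hy =>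
    simp only [map_add, hx, hy]
    abel
  | single L v =>
    rw [homotopy, consL_single, Finsupp.lsum_single, Finsupp.lsum_single, homotopyList,
      if_neg (fun h' => h h'.ge), if_neg h]
    rfl

theorem remove_cons_self (L : List (Finset (Fin n))) (v : V) :
    remove K V B (Finsupp.single (B :: L) v) =
      (-1 : ℤˣ) ^ L.length • Finsupp.single L v := by
  rw [remove, Finsupp.lsum_single, removeList, if_pos rfl]
  rfl

theorem remove_consL_of_subset (h : B ⊆ P) (h' : P ≠ B) (z : ListChain n V) :
    remove K V B (consL K V P z) = 0 := by
  induction z using Finsupp.induction_linear with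
  | zero => simp
  | add x y hx hy => simp only [map_add, hx, hy, add_zero]
  | single L v =>
    rw [remove, consL_single, Finsupp.lsum_single, removeList, if_neg h', if_pos h]
    rfl

theorem remove_consL_of_not_subset (h : ¬ B ⊆ P) (z : ListChain n V) :
    remove K V B (consL K V P z) = consL K V P (remove K V B z) := by
  induction z using Finsupp.induction_linear with
  | zero => simp
  | add x y hx hy => simp only [map_add, hx, hy]
  | single L v =>
    rw [remove, consL_single, Finsupp.lsum_single, Finsupp.lsum_single, removeList,
      if_neg (fun h' => h h'.ge), if_neg h]
    rfl

variable {X} (hB : B ∈ X.parts)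
include hB

theorem sum_splits_consL (C : Finset (Fin n)) (hC : Saturated X C)
    (hC0 : C.Nonempty) (hBC : Disjoint B C) (z : ListChain n V) :
    ∑ A ∈ splits X (C ∪ B), consL K V A (consL K V ((C ∪ B) \ A) z) =
      consL K V B (consL K V C z) + consL K V C (consL K V B z) +
        ∑ A ∈ splits X C, (consL K V (A ∪ B) (consL K V (C \ A) z) +
          consL K V A (consL K V (C \ A ∪ B) z)) := by
  rw [sum_splits_union hB hC hC0 hBC, Finset.union_sdiff_cancel_right hBC.symm,
    Finset.union_sdiff_cancel_left hBC.symm]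
  congr 1
  refine Finset.sum_congr rfl fun A hA => ?_
  have hBA : Disjoint B A := hBC.mono_right (mem_splits.mp hA).1
  have h1 : (C ∪ B) \ (A ∪ B) = C \ A := by
    ext i
    have h0 : i ∈ B → i ∉ C := fun h => Finset.disjoint_left.mp hBC h
    simp only [Finset.mem_sdiff, Finset.mem_union]
    tauto
  have h2 : (C ∪ B) \ A = C \ A ∪ B := by
    rw [Finset.union_sdiff_distrib, Finset.sdiff_eq_self_of_disjoint hBA]
  rw [h1, h2]

/-- Splitting `C ∪ B` either splits `C` or separates `B` from `C`. The terms of the first kind give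
`ins` of the boundary. Those of the second kind place `B` just before or just after `C`; they
telescope, leaving `B` at the front and at the end. -/
theorem bd_ins (L : List (Finset (Fin n)))
    (hL : ∀ C ∈ L, Saturated X C ∧ C.Nonempty ∧ Disjoint B C) (v : V) :
    bd K V X (ins K V B (Finsupp.single L v)) = ins K V B (bd K V X (Finsupp.single L v)) +
      Finsupp.single (B :: L) v - (-1 : ℤˣ) ^ L.length • Finsupp.single (L ++ [B]) v := by
  induction L with
  | nil => simp [ins_nil, bd_nil]
  | cons C L ih =>
    obtain ⟨hC, hC0, hBC⟩ := hL C (by simp)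
    have ih := ih fun C hC => hL C (List.mem_cons_of_mem _ hC)
    have e : Finsupp.single ((C :: L) ++ [B]) v =
        consL K V C (Finsupp.single (L ++ [B]) v) := by rw [consL_single]; rfl
    rw [e, ← consL_single (K := K) B, ← consL_single (K := K) C]
    rw [← consL_single (K := K) B] at ih
    generalize Finsupp.single (L ++ [B]) v = y at ih ⊢
    generalize Finsupp.single L v = z at ih ⊢
    have hs : ins K V B (∑ A ∈ splits X C, consL K V A (consL K V (C \ A) z)) =
        ∑ A ∈ splits X C, (consL K V (A ∪ B) (consL K V (C \ A) z) +
          (consL K V A (consL K V (C \ A ∪ B) z) +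
            consL K V A (consL K V (C \ A) (ins K V B z)))) := by
      rw [map_sum]
      simp only [ins_consL, map_add]
    rw [ins_consL, map_add, bd_consL, bd_consL, sum_splits_consL hB C hC hC0 hBC, ih, bd_consL,
      map_sub (ins K V B), hs, ins_consL]
    simp only [Finset.sum_add_distrib, map_add, map_sub, Units.smul_def, map_zsmul]
    simp only [List.length_cons, pow_succ, Units.val_mul, mul_smul, Units.val_neg, Units.val_one,
      neg_smul, one_smul, smul_neg]
    abel

/-- Up to homotopy every chain is pushed onto lists that end in `B`. If the first member is `B`,
this is `bd_ins`; if it is disjoint from `B`, the formula is inherited from the tail. -/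
theorem homotopy_bd (L : List (Finset (Fin n)))
    (hL : ∀ C ∈ L, Saturated X C ∧ C.Nonempty) (hd : L.Pairwise Disjoint) (hBL : ∃ C ∈ L, B ⊆ C)
    (v : V) :
    homotopy K V B (bd K V X (Finsupp.single L v)) + bd K V X (homotopy K V B (Finsupp.single L v)) =
      Finsupp.single L v - appL K V B (remove K V B (Finsupp.single L v)) := by
  induction L with
  | nil => simp at hBL
  | cons P L ih =>
    obtain ⟨hP, hP0⟩ := hL P (by simp)
    rw [List.pairwise_cons] at hd
    by_cases hPB : P = B
    · subst hPB
      rw [remove_cons_self, ← consL_single (K := K), homotopy_consL_self, bd_consL,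
        splits_of_mem hB, bd_ins hB L fun C hC => ⟨(hL C (List.mem_cons_of_mem _ hC)).1,
          (hL C (List.mem_cons_of_mem _ hC)).2, hd.1 C hC⟩, Finset.sum_empty, zero_sub, map_neg,
        homotopy_consL_self, consL_single]
      simp only [Units.smul_def, map_zsmul, appL_single]
      abel
    · by_cases hBP : B ⊆ P
      · have hC : Saturated X (P \ B) := hP.sdiff (saturated_of_mem hB)
        have hC0 : (P \ B).Nonempty := Finset.sdiff_nonempty.mpr fun h => hPB (h.antisymm hBP)
        have hBC : Disjoint B (P \ B) := Finset.disjoint_sdiff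
        have hb : B.Nonempty := X.nonempty_of_mem_parts hB
        have hns : ∀ A ⊆ P \ B, ¬ B ⊆ A := fun A hA h => by
          obtain ⟨b, hb⟩ := hb
          exact (Finset.mem_sdiff.mp (hA (h hb))).2 hb
        have hne : ∀ A ⊆ P \ B, A.Nonempty → A ∪ B ≠ B := fun A hA h0 h => by
          obtain ⟨a, ha⟩ := h0
          exact (Finset.mem_sdiff.mp (hA ha)).2 (h ▸ Finset.mem_union_left _ ha)
        have hPe : P \ B ∪ B = P := Finset.sdiff_union_of_subset hBP
        -- Among the splittings of `P`, only `B, P \ B` and `P \ B, B` survive the homotopy. Their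
        -- terms from inserting `B` into `L` cancel, and inserting `B` into `P \ B` gives back `P ::
        -- L`.
        have key := sum_splits_consL (K := K) hB (P \ B) hC hC0 hBC (Finsupp.single L v)
        rw [hPe] at key
        rw [← consL_single (K := K), homotopy_consL_of_subset hBP hPB,
          remove_consL_of_subset hBP hPB, bd_consL, map_sub, key,
          homotopy_consL_of_subset hBP hPB, map_add, map_add, homotopy_consL_self, map_sum,
          homotopy_consL_of_not_subset (hns _ le_rfl), homotopy_consL_self, ins_consL, hPe,
          Finset.sum_eq_zero]
        · simp
        · intro A hA
          obtain ⟨h1, h2, h3, h4⟩ := mem_splits.mp hA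
          rw [map_add, homotopy_consL_of_subset Finset.subset_union_right (hne A h1 h2),
            homotopy_consL_of_not_subset (hns A h1),
            homotopy_consL_of_subset Finset.subset_union_right (hne _ Finset.sdiff_subset
              (mem_splits.mp (sdiff_mem_splits hC hA)).2.1)]
          simp
      · have hBL' : ∃ C ∈ L, B ⊆ C := by
          obtain ⟨C, hC, hBC⟩ := hBL
          refine ⟨C, (List.mem_cons.mp hC).resolve_left ?_, hBC⟩
          rintro rfl
          exact hBP hBC
        have ih := ih (fun C hC => hL C (List.mem_cons_of_mem _ hC)) hd.2 hBL'
        rw [← consL_single (K := K)]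
        generalize Finsupp.single L v = z at ih ⊢
        have h1 : ∑ A ∈ splits X P, homotopy K V B (consL K V A (consL K V (P \ A) z)) =
            ∑ A ∈ splits X P, consL K V A (consL K V (P \ A) (homotopy K V B z)) := by
          refine Finset.sum_congr rfl fun A hA => ?_
          rw [homotopy_consL_of_not_subset fun h => hBP (h.trans (mem_splits.mp hA).1),
            homotopy_consL_of_not_subset fun h => hBP (h.trans Finset.sdiff_subset), map_neg,
            neg_neg]
        rw [remove_consL_of_not_subset hBP, homotopy_consL_of_not_subset hBP, bd_consL, map_sub,
          map_sum, h1, homotopy_consL_of_not_subset hBP, map_neg, bd_consL, appL_consL, ← map_sub,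
          ← ih, map_add]
        abel

end Operators

/-! ### Ordered set partitions of unions of blocks -/

variable {n : ℕ} (X : Finpartition (Finset.univ : Finset (Fin n)))

/-- `L` is an ordered set partition of the union of the set `T` of blocks of `X` into saturated
sets. -/
structure IsOrdering (T : Finset (Finset (Fin n))) (L : List (Finset (Fin n))) : Prop where
  nonempty : ∀ P ∈ L, P.Nonempty
  saturated : ∀ P ∈ L, Saturated X P
  disjoint : L.Pairwise Disjoint
  mem_iff : ∀ B ∈ X.parts, (B ∈ T ↔ ∃ P ∈ L, B ⊆ P)

namespace IsOrdering

variable {X} {T : Finset (Finset (Fin n))} {L L' : List (Finset (Fin n))}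
  {A B P : Finset (Fin n)}

/-- Permutation invariance allows splitting, merging and removing to be treated at the head of a
list only. -/
theorem perm (h : IsOrdering X T L) (hL : L.Perm L') : IsOrdering X T L' where
  nonempty P hP := h.nonempty P (hL.mem_iff.mpr hP)
  saturated P hP := h.saturated P (hL.mem_iff.mpr hP)
  disjoint := (hL.pairwise_iff fun h => h.symm).mp h.disjoint
  mem_iff B hB := by simp only [h.mem_iff B hB, hL.mem_iff]

theorem split (h : IsOrdering X T (P :: L)) (hA : A ∈ splits X P) :
    IsOrdering X T (A :: (P \ A) :: L) := by
  have hP := h.saturated P (by simp)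
  obtain ⟨a1, a2, a3, a4⟩ := mem_splits.mp hA
  obtain ⟨b1, b2, b3, b4⟩ := mem_splits.mp (sdiff_mem_splits hP hA)
  have hd := List.pairwise_cons.mp h.disjoint
  refine ⟨?_, ?_, ?_, fun B hB => (h.mem_iff B hB).trans ?_⟩
  · simpa [a2, b2] using fun P hP => h.nonempty P (List.mem_cons_of_mem _ hP)
  · simpa [a4, b4] using fun P hP => h.saturated P (List.mem_cons_of_mem _ hP)
  · refine List.pairwise_cons.mpr ⟨fun Q hQ => ?_, List.pairwise_cons.mpr
      ⟨fun Q hQ => (hd.1 Q hQ).mono_left b1, hd.2⟩⟩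
    rcases List.mem_cons.mp hQ with rfl | hQ
    · exact Finset.disjoint_sdiff
    · exact (hd.1 Q hQ).mono_left a1
  · simp only [List.mem_cons, exists_eq_or_imp]
    rw [← or_assoc]
    refine or_congr_left ⟨fun h => ?_, fun h => h.elim (·.trans a1) (·.trans b1)⟩
    by_cases hBA : B ⊆ A
    · exact Or.inl hBA
    · exact Or.inr (Finset.subset_sdiff.mpr ⟨h, a4.disjoint_of_not_subset hB hBA⟩)

theorem merge (h : IsOrdering X T (B :: P :: L)) (hB : B ∈ X.parts) :
    IsOrdering X T ((P ∪ B) :: L) := by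
  have hP := h.saturated P (by simp)
  have hd := List.pairwise_cons.mp h.disjoint
  have hd' := List.pairwise_cons.mp hd.2
  refine ⟨?_, ?_, ?_, fun B' hB' => (h.mem_iff B' hB').trans ?_⟩
  · simpa [h.nonempty P (by simp)] using fun P hP => h.nonempty P (by simp [hP])
  · simpa [hP.union (saturated_of_mem hB)] using fun P hP => h.saturated P (by simp [hP])
  · refine List.pairwise_cons.mpr ⟨fun Q hQ => ?_, hd'.2⟩
    exact Finset.disjoint_union_left.mpr ⟨hd'.1 Q hQ, hd.1 Q (by simp [hQ])⟩
  · simp only [List.mem_cons, exists_eq_or_imp]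
    rw [← or_assoc]
    refine or_congr_left ⟨fun h => ?_, fun h => ?_⟩
    · exact h.elim (·.trans Finset.subset_union_right) (·.trans Finset.subset_union_left)
    · by_cases hBP : B' ⊆ P
      · exact Or.inr hBP
      · exact Or.inl ((hP.disjoint_of_not_subset hB' hBP).left_le_of_le_sup_left h)

theorem tail (h : IsOrdering X (insert B T) (B :: L)) (hB : B ∈ X.parts) (hBT : B ∉ T) :
    IsOrdering X T L := by
  have hd := List.pairwise_cons.mp h.disjoint
  obtain ⟨b, hb⟩ := X.nonempty_of_mem_parts hB
  refine ⟨fun P hP => h.nonempty P (by simp [hP]), fun P hP => h.saturated P (by simp [hP]), hd.2,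
    fun B' hB' => ⟨fun hT => ?_, ?_⟩⟩
  · obtain ⟨P, hP, hBP⟩ := (h.mem_iff B' hB').mp (Finset.mem_insert_of_mem hT)
    refine ⟨P, (List.mem_cons.mp hP).resolve_left ?_, hBP⟩
    rintro rfl
    obtain ⟨i, hi⟩ := X.nonempty_of_mem_parts hB'
    exact hBT (X.eq_of_mem_parts hB' hB hi (hBP hi) ▸ hT)
  · rintro ⟨P, hP, hBP⟩
    refine (Finset.mem_insert.mp ((h.mem_iff B' hB').mpr ⟨P, by simp [hP], hBP⟩)).resolve_left ?_
    rintro rfl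
    exact Finset.disjoint_left.mp (hd.1 P hP) hb (hBP hb)

theorem append (h : IsOrdering X T L) (hB : B ∈ X.parts) (hBT : B ∉ T) :
    IsOrdering X (insert B T) (L ++ [B]) := by
  refine IsOrdering.perm (L := B :: L) ?_ (List.perm_append_singleton B L).symm
  refine ⟨?_, ?_, List.pairwise_cons.mpr ⟨fun P hP => ?_, h.disjoint⟩, fun B' hB' => ?_⟩
  · simpa [X.nonempty_of_mem_parts hB] using h.nonempty
  · simpa [saturated_of_mem hB] using h.saturated
  · exact (h.saturated P hP).disjoint_of_not_subset hB fun hBP =>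
      hBT ((h.mem_iff B hB).mpr ⟨P, hP, hBP⟩)
  · simp only [List.mem_cons, exists_eq_or_imp, Finset.mem_insert, h.mem_iff B' hB']
    refine or_congr_left ⟨fun h => h.le, fun h => ?_⟩
    obtain ⟨i, hi⟩ := X.nonempty_of_mem_parts hB'
    exact X.eq_of_mem_parts hB' hB hi (h hi)

theorem eq_nil (h : IsOrdering X ∅ L) : L = [] := by
  refine List.eq_nil_iff_forall_not_mem.mpr fun P hP => ?_
  obtain ⟨i, hi⟩ := h.nonempty P hP
  obtain ⟨B, hB, hiB⟩ := X.exists_mem (Finset.mem_univ i)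
  simpa using (h.mem_iff B hB).mpr ⟨P, hP, h.saturated P hP B hB i hiB hi⟩

end IsOrdering

/-! ### Supports of the operators, and exactness -/

section Support

variable {K : Type u} [Field K] {V : Type w} [AddCommGroup V] [Module K V]

theorem map_mem_supported {ι κ : Type*} {V W : Type*} [AddCommGroup V] [Module K V]
    [AddCommGroup W] [Module K W] {f : (ι →₀ V) →ₗ[K] (κ →₀ W)} {s : Set ι} {t : Set κ}
    (h : ∀ L ∈ s, ∀ v, f (Finsupp.single L v) ∈ Finsupp.supported W K t) {z : ι →₀ V}
    (hz : z ∈ Finsupp.supported V K s) : f z ∈ Finsupp.supported W K t := by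
  rw [← Finsupp.sum_single z, map_finsuppSum]
  exact Submodule.sum_mem _ fun L hL => h L (hz hL) _

theorem consL_mem_supported {s t : Set (List (Finset (Fin n)))} {P : Finset (Fin n)}
    (h : ∀ L ∈ s, P :: L ∈ t) {z : ListChain n V} (hz : z ∈ Finsupp.supported V K s) :
    consL K V P z ∈ Finsupp.supported V K t := by
  refine map_mem_supported (fun L hL v => ?_) hz
  rw [consL_single]
  exact Finsupp.single_mem_supported K v (h L hL)

theorem bd_single_mem_supported (L : List (Finset (Fin n))) (v : V) :
    bd K V X (Finsupp.single L v) ∈ Finsupp.supported V K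
      {L' | ∃ L₁ P L₂, ∃ A ∈ splits X P, L = L₁ ++ P :: L₂ ∧ L' = L₁ ++ A :: (P \ A) :: L₂} := by
  induction L with
  | nil =>
    rw [bd_nil]
    exact zero_mem _
  | cons P L ih =>
    rw [← consL_single (K := K), bd_consL]
    refine Submodule.sub_mem _ (Submodule.sum_mem _ fun A hA => ?_) (consL_mem_supported ?_ ih)
    · rw [consL_single, consL_single]
      exact Finsupp.single_mem_supported K v ⟨[], P, L, A, hA, rfl, rfl⟩
    · rintro _ ⟨L₁, Q, L₂, A, hA, rfl, rfl⟩
      exact ⟨P :: L₁, Q, L₂, A, hA, rfl, rfl⟩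

theorem ins_single_mem_supported (B : Finset (Fin n)) (L : List (Finset (Fin n))) (v : V) :
    ins K V B (Finsupp.single L v) ∈ Finsupp.supported V K
      {L' | ∃ L₁ P L₂, L = L₁ ++ P :: L₂ ∧ L' = L₁ ++ (P ∪ B) :: L₂} := by
  induction L with
  | nil =>
    rw [ins_nil]
    exact zero_mem _
  | cons P L ih =>
    rw [← consL_single (K := K), ins_consL]
    refine Submodule.add_mem _ ?_ (consL_mem_supported ?_ ih)
    · rw [consL_single]
      exact Finsupp.single_mem_supported K v ⟨[], P, L, rfl, rfl⟩
    · rintro _ ⟨L₁, Q, L₂, rfl, rfl⟩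
      exact ⟨P :: L₁, Q, L₂, rfl, rfl⟩

theorem homotopy_single_mem_supported (B : Finset (Fin n)) (L : List (Finset (Fin n))) (v : V) :
    homotopy K V B (Finsupp.single L v) ∈ Finsupp.supported V K
      {L' | ∃ L₁ L₂ P L₃, L = L₁ ++ B :: (L₂ ++ P :: L₃) ∧
        L' = L₁ ++ (L₂ ++ (P ∪ B) :: L₃)} := by
  induction L with
  | nil =>
    rw [homotopy, Finsupp.lsum_single]
    exact zero_mem _
  | cons P L ih =>
    rw [← consL_single (K := K)]
    by_cases hPB : P = B
    · subst hPB
      rw [homotopy_consL_self]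
      refine Finsupp.supported_mono ?_ (ins_single_mem_supported P L v)
      rintro _ ⟨L₁, Q, L₂, rfl, rfl⟩
      exact ⟨[], L₁, Q, L₂, rfl, rfl⟩
    · by_cases hBP : B ⊆ P
      · rw [homotopy_consL_of_subset hBP hPB]
        exact zero_mem _
      · rw [homotopy_consL_of_not_subset hBP]
        refine Submodule.neg_mem _ (consL_mem_supported ?_ ih)
        rintro _ ⟨L₁, L₂, Q, L₃, rfl, rfl⟩
        exact ⟨P :: L₁, L₂, Q, L₃, rfl, rfl⟩

theorem remove_single_mem_supported (B : Finset (Fin n)) (L : List (Finset (Fin n))) (v : V) :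
    remove K V B (Finsupp.single L v) ∈ Finsupp.supported V K
      {L' | ∃ L₁ L₂, L = L₁ ++ B :: L₂ ∧ L' = L₁ ++ L₂} := by
  induction L with
  | nil =>
    rw [remove, Finsupp.lsum_single]
    exact zero_mem _
  | cons P L ih =>
    by_cases hPB : P = B
    · subst hPB
      rw [remove_cons_self, Units.smul_def]
      have h : Finsupp.single L v ∈ Finsupp.supported V K
          {L' | ∃ L₁ L₂, P :: L = L₁ ++ P :: L₂ ∧ L' = L₁ ++ L₂} :=
        Finsupp.single_mem_supported K v ⟨[], L, rfl, rfl⟩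
      exact zsmul_mem h _
    · rw [← consL_single (K := K)]
      by_cases hBP : B ⊆ P
      · rw [remove_consL_of_subset hBP hPB]
        exact zero_mem _
      · rw [remove_consL_of_not_subset hBP]
        refine consL_mem_supported ?_ ih
        rintro _ ⟨L₁, L₂, rfl, rfl⟩
        exact ⟨P :: L₁, L₂, rfl, rfl⟩

variable (K V) in
/-- The chains on ordered set partitions of the union of `T` into `r` saturated sets. -/
def orderingChains (T : Finset (Finset (Fin n))) (r : ℕ) : Submodule K (ListChain n V) :=
  Finsupp.supported V K {L | IsOrdering X T L ∧ L.length = r}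

variable {X} {T : Finset (Finset (Fin n))} {B : Finset (Fin n)} {r : ℕ} {z : ListChain n V}

theorem bd_mem_orderingChains (hz : z ∈ orderingChains X K V T r) :
    bd K V X z ∈ orderingChains X K V T (r + 1) := by
  refine map_mem_supported (fun L hL v => ?_) hz
  refine Finsupp.supported_mono ?_ (bd_single_mem_supported X L v)
  rintro _ ⟨L₁, P, L₂, A, hA, rfl, rfl⟩
  refine ⟨?_, by simpa [← hL.2] using by ring⟩
  refine ((hL.1.perm List.perm_middle).split hA).perm ?_
  exact ((List.perm_middle (a := P \ A)).symm.cons A).trans List.perm_middle.symm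

theorem homotopy_mem_orderingChains (hB : B ∈ X.parts)
    (hz : z ∈ orderingChains X K V T (r + 1)) :
    homotopy K V B z ∈ orderingChains X K V T r := by
  refine map_mem_supported (fun L hL v => ?_) hz
  refine Finsupp.supported_mono ?_ (homotopy_single_mem_supported B L v)
  rintro _ ⟨L₁, L₂, P, L₃, rfl, rfl⟩
  have hlen := hL.2
  simp only [List.length_append, List.length_cons] at hlen
  refine ⟨?_, by simp only [List.length_append, List.length_cons]; omega⟩
  have h1 : (L₁ ++ B :: (L₂ ++ P :: L₃)).Perm (B :: P :: (L₁ ++ (L₂ ++ L₃))) := by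
    refine List.perm_middle.trans (List.Perm.cons B ?_)
    refine (List.Perm.append_left L₁ List.perm_middle).trans List.perm_middle
  refine ((hL.1.perm h1).merge hB).perm ?_
  exact (List.perm_middle.symm.trans (List.Perm.append_left L₁ List.perm_middle.symm))

theorem remove_mem_orderingChains (hB : B ∈ X.parts) (hBT : B ∉ T)
    (hz : z ∈ orderingChains X K V (insert B T) (r + 1)) :
    remove K V B z ∈ orderingChains X K V T r := by
  refine map_mem_supported (fun L hL v => ?_) hz
  refine Finsupp.supported_mono ?_ (remove_single_mem_supported B L v)
  rintro _ ⟨L₁, L₂, rfl, rfl⟩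
  have hlen := hL.2
  simp only [List.length_append, List.length_cons] at hlen
  exact ⟨(hL.1.perm List.perm_middle).tail hB hBT, by simp only [List.length_append]; omega⟩

theorem homotopy_bd_eq (hB : B ∈ X.parts) (hBT : B ∈ T) (hz : z ∈ orderingChains X K V T r) :
    homotopy K V B (bd K V X z) + bd K V X (homotopy K V B z) =
      z - appL K V B (remove K V B z) := by
  rw [← Finsupp.sum_single z]
  simp only [Finsupp.sum, map_sum]
  rw [← Finset.sum_add_distrib, ← Finset.sum_sub_distrib]
  refine Finset.sum_congr rfl fun L hL => ?_
  obtain ⟨h, -⟩ := hz hL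
  exact homotopy_bd hB L (fun C hC => ⟨h.saturated C hC, h.nonempty C hC⟩) h.disjoint
    ((h.mem_iff B hB).mp hBT) _

/-- The complex of ordered set partitions is exact except at its end, where the homology is
one-dimensional. -/
theorem exists_eq_bd_add_single (T : Finset (Finset (Fin n))) (hT : T ⊆ X.parts) :
    ∃ l : List (Finset (Fin n)), l.length = T.card ∧
      ∀ r, ∀ z ∈ orderingChains X K V T r, bd K V X z = 0 →
        ∃ y ∈ Finsupp.supported V K {L | IsOrdering X T L ∧ L.length + 1 = r},
          ∃ v, z = bd K V X y + Finsupp.single l v := by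
  induction T using Finset.induction_on with
  | empty =>
    refine ⟨[], rfl, fun r z hz _ => ⟨0, zero_mem _, z [], ?_⟩⟩
    ext L
    rw [map_zero, zero_add, Finsupp.single_apply]
    split_ifs with h
    · rw [h]
    · by_contra hL
      exact h (hz (Finsupp.mem_support_iff.mpr hL)).1.eq_nil.symm
  | insert B T hBT ih =>
    have hB : B ∈ X.parts := hT (Finset.mem_insert_self B T)
    obtain ⟨l, hl, ih⟩ := ih ((Finset.subset_insert B T).trans hT)
    refine ⟨l ++ [B], by simp [hl, Finset.card_insert_of_notMem hBT], fun r z hz hbd => ?_⟩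
    -- Removing `B` lowers the length by one, so length zero is separate: no empty list orders the
    -- non-empty set `insert B T`.
    obtain _ | r := r
    · have : z = 0 := by
        refine Finsupp.support_eq_empty.mp (Finset.eq_empty_of_forall_notMem fun L hL => ?_)
        obtain ⟨h1, h2⟩ := hz hL
        obtain ⟨P, hP, -⟩ := (h1.mem_iff B hB).mp (Finset.mem_insert_self B T)
        rw [List.length_eq_zero_iff.mp h2] at hP
        simp at hP
      exact ⟨0, zero_mem _, 0, by simp [this]⟩
    -- For a cycle, `z` differs from `appL (remove z)` by the boundary of `homotopy z`. Moreover
    -- `remove z` is a cycle, because `appL` is injective and commutes with the boundary, so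
    -- induction applies to it.
    · have e := homotopy_bd_eq hB (Finset.mem_insert_self B T) hz
      rw [hbd, map_zero, zero_add] at e
      have hw : bd K V X (remove K V B z) = 0 := by
        apply appL_injective (K := K) (V := V) B
        rw [← bd_appL X hB, map_zero]
        have := congrArg (bd K V X) e
        rw [bd_bd, map_sub, hbd, zero_sub, eq_comm, neg_eq_zero] at this
        exact this
      obtain ⟨y, hy, v, hyv⟩ := ih r _ (remove_mem_orderingChains hB hBT hz) hw
      refine ⟨homotopy K V B z + appL K V B y, add_mem ?_ (map_mem_supported ?_ hy), v, ?_⟩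
      · refine Finsupp.supported_mono ?_ (homotopy_mem_orderingChains hB hz)
        exact fun L hL => ⟨hL.1, congrArg (· + 1) hL.2⟩
      · intro L hL v
        rw [appL_single]
        exact Finsupp.single_mem_supported K v ⟨hL.1.append hB hBT, by simp [hL.2]⟩
      · rw [hyv, map_add, appL_single, ← bd_appL X hB] at e
        rw [map_add, e]
        abel

end Support

/-! ### Signs independent of the order of the blocks -/

section Signs

variable {n : ℕ}

/-- The sign of a pair of sets with respect to a fixed linear order on all sets. -/
noncomputable def ordSign (P Q : Finset (Fin n)) : ℤˣ :=
  if Fintype.equivFin _ P < Fintype.equivFin _ Q then 1 else -1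

theorem ordSign_swap {P Q : Finset (Fin n)} (h : P ≠ Q) : ordSign Q P = - ordSign P Q := by
  have h' : Fintype.equivFin _ P ≠ Fintype.equivFin _ Q :=
    fun e => h ((Fintype.equivFin _).injective e)
  rw [ordSign, ordSign]
  rcases h'.lt_or_gt with h' | h'
  · rw [if_neg h'.asymm, if_pos h']
  · rw [if_pos h', if_neg h'.asymm, neg_neg]

/-- The sign of a list of distinct sets, as a permutation of its entries. -/
noncomputable def listSign : List (Finset (Fin n)) → ℤˣ
  | [] => 1
  | P :: L => (L.map (ordSign P)).prod * listSign L

theorem listSign_append (L M : List (Finset (Fin n))) :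
    listSign (L ++ M) =
      listSign L * listSign M * (L.map fun P => (M.map (ordSign P)).prod).prod := by
  induction L with
  | nil => simp [listSign]
  | cons P L ih =>
    simp only [List.cons_append, listSign, ih, List.map_append, List.prod_append, List.map_cons,
      List.prod_cons]
    ac_rfl

/-- The list obtained from `L` by replacing `P` with `A, P \ A`. -/
def splitList (L : List (Finset (Fin n))) (P A : Finset (Fin n)) : List (Finset (Fin n)) :=
  L.flatMap fun Q => if Q = P then [A, P \ A] else [Q]

theorem splitList_of_notMem {L : List (Finset (Fin n))} {P A : Finset (Fin n)} (h : P ∉ L) :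
    splitList L P A = L := by
  induction L with
  | nil => rfl
  | cons Q L ih =>
    rw [List.mem_cons, not_or] at h
    rw [splitList, List.flatMap_cons, if_neg (Ne.symm h.1), ← splitList, ih h.2]
    rfl

theorem splitList_append_cons {L M : List (Finset (Fin n))} {P A : Finset (Fin n)}
    (hL : P ∉ L) (hM : P ∉ M) :
    splitList (L ++ P :: M) P A = L ++ A :: (P \ A) :: M := by
  have h1 := splitList_of_notMem (A := A) hL
  have h2 := splitList_of_notMem (A := A) hM
  rw [splitList] at h1 h2
  rw [splitList, List.flatMap_append, List.flatMap_cons, h1, h2, if_pos rfl]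
  rfl

/-- The coefficient of the list that splits `P` into `A, P \ A` in the boundary of an ordered set
partition with set of blocks `s`. -/
noncomputable def splitSign (s : Finset (Finset (Fin n))) (P A : Finset (Fin n)) : ℤˣ :=
  ordSign A (P \ A) * ∏ Q ∈ s.erase P, ordSign A Q * ordSign (P \ A) Q * ordSign P Q

/-- Exchanging the two parts flips the leading `ordSign`; the remaining product is symmetric in
them. -/
theorem splitSign_sdiff (s : Finset (Finset (Fin n))) {P A : Finset (Fin n)} (hA : A ⊆ P)
    (h : A ≠ P \ A) : splitSign s P (P \ A) = - splitSign s P A := by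
  rw [splitSign, splitSign, Finset.sdiff_sdiff_eq_self hA, ordSign_swap h, neg_mul]
  congr 2
  exact Finset.prod_congr rfl fun Q _ => by rw [mul_comm (ordSign (P \ A) Q)]

theorem splitSign_eq {L M : List (Finset (Fin n))} {P A : Finset (Fin n)}
    (hn : (L ++ P :: M).Nodup) (hA : A ∉ L) (hA' : P \ A ∉ L) :
    (-1) ^ L.length = listSign (L ++ A :: (P \ A) :: M) * listSign (L ++ P :: M) *
      splitSign (L ++ P :: M).toFinset P A := by
  have hPL : P ∉ L ++ M := (List.nodup_middle.mp hn).notMem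
  have hn' : (L ++ M).Nodup := (List.nodup_cons.mp (List.nodup_middle.mp hn)).2
  have hs : (L ++ P :: M).toFinset.erase P = (L ++ M).toFinset := by
    ext Q
    simp only [Finset.mem_erase, List.mem_toFinset, List.mem_append, List.mem_cons] at hPL ⊢
    constructor
    · tauto
    · exact fun h => ⟨fun e => hPL (e ▸ h), by tauto⟩
  rw [splitSign, hs, List.prod_toFinset _ hn', listSign_append, listSign_append]
  simp only [listSign, List.map_cons, List.prod_cons, List.map_append, List.prod_append,
    List.prod_map_mul]
  -- Each member of `L` is compared with `A`, `P \ A` and `P` once in either order; the three swaps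
  -- contribute `-1`. All other signs occur twice and cancel.
  have hL : (L.map fun Q => ordSign Q A).prod * (L.map fun Q => ordSign Q (P \ A)).prod *
      (L.map fun Q => ordSign Q P).prod * ((L.map (ordSign A)).prod *
        (L.map (ordSign (P \ A))).prod * (L.map (ordSign P)).prod) = (-1) ^ L.length := by
    have hPL' : P ∉ L := fun h => hPL (List.mem_append_left _ h)
    clear hn hPL hn' hs
    induction L with
    | nil => simp
    | cons Q L ih =>
      rw [List.mem_cons, not_or] at hA hA' hPL'
      rw [List.length_cons, pow_succ, ← ih hA.2 hA'.2 hPL'.2]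
      simp only [List.map_cons, List.prod_cons, ordSign_swap hA.1, ordSign_swap hA'.1,
        ordSign_swap hPL'.1]
      have e (a b c x₁ x₂ x₃ x₄ x₅ x₆ : ℤˣ) : -a * x₁ * (-b * x₂) * (-c * x₃) *
          (a * x₄ * (b * x₅) * (c * x₆)) = x₁ * x₂ * x₃ * (x₄ * x₅ * x₆) * -1 := by
        rw [show -a * x₁ * (-b * x₂) * (-c * x₃) * (a * x₄ * (b * x₅) * (c * x₆)) =
          ((a * a) * (b * b) * (c * c)) * (x₁ * x₂ * x₃ * (x₄ * x₅ * x₆)) * -1 by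
            simp only [neg_mul, mul_neg, neg_neg, mul_one]; congr 1; ac_rfl]
        simp only [Int.units_mul_self, one_mul]
      exact e _ _ _ _ _ _ _ _ _
  rw [← hL]
  have e (s t d o a b c a' b' c' x y z : ℤˣ) : a * b * c * (a' * b' * c') =
      s * (o * x * (y * t)) * (a * (b * d)) * (s * (z * t) * (c * d)) *
        (o * (a' * b' * c' * (x * y * z))) := by
    rw [show s * (o * x * (y * t)) * (a * (b * d)) * (s * (z * t) * (c * d)) *
        (o * (a' * b' * c' * (x * y * z))) = (s * s) * (t * t) * (d * d) * (o * o) * (x * x) *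
          (y * y) * (z * z) * (a * b * c * (a' * b' * c')) by ac_rfl]
    simp only [Int.units_mul_self, one_mul]
  exact e _ _ _ _ _ _ _ _ _ _ _ _ _

variable {K : Type u} [Field K] {V : Type w} [AddCommGroup V] [Module K V]
  (X : Finpartition (Finset.univ : Finset (Fin n)))

/-- The prefix `L` keeps track of the sign that the recursion for `bd` accumulates, and
`splitSign_eq` turns this sign into a ratio of list signs. -/
theorem smul_bd_single (L M : List (Finset (Fin n))) (hd : (L ++ M).Pairwise Disjoint)
    (h0 : ∀ P ∈ L ++ M, P.Nonempty) (v : V) :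
    (-1 : ℤˣ) ^ L.length •
        Finsupp.lmapDomain V K (L ++ ·) (bd K V X (Finsupp.single M v)) =
      ∑ P ∈ M.toFinset, ∑ A ∈ splits X P, (listSign (splitList (L ++ M) P A) *
        listSign (L ++ M) * splitSign (L ++ M).toFinset P A) •
          Finsupp.single (splitList (L ++ M) P A) v := by
  induction M generalizing L with
  | nil => simp [bd_nil]
  | cons P M ih =>
    have hn : (L ++ P :: M).Nodup := hd.imp_of_mem fun {Q R} hQ hR h e => by
      obtain ⟨i, hi⟩ := h0 Q hQ
      exact Finset.disjoint_left.mp h hi (e ▸ hi)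
    have hPL : P ∉ L ++ M := (List.nodup_middle.mp hn).notMem
    rw [List.mem_append, not_or] at hPL
    have hsub {A} (hA : A ⊆ P) (hA0 : A.Nonempty) : A ∉ L := fun h => by
      obtain ⟨i, hi⟩ := hA0
      exact Finset.disjoint_left.mp ((List.pairwise_append.mp hd).2.2 A h P (by simp)) hi (hA hi)
    have e : L ++ P :: M = (L ++ [P]) ++ M := by simp
    have ih := ih (L ++ [P]) (e ▸ hd) (e ▸ h0)
    rw [← e, List.length_append, List.length_singleton, pow_succ, mul_neg_one] at ih
    have hlist : (Finsupp.lmapDomain V K (L ++ ·)) ∘ₗ consL K V P =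
        Finsupp.lmapDomain V K (L ++ [P] ++ ·) := by
      refine Finsupp.lhom_ext fun M v => ?_
      rw [LinearMap.comp_apply, consL_single]
      simp [Finsupp.mapDomain_single]
    rw [List.toFinset_cons, Finset.sum_insert (by simpa using hPL.2), ← ih, ← consL_single (K := K),
      bd_consL, map_sub, smul_sub, map_sum, Finset.smul_sum, sub_eq_add_neg, ← hlist]
    congr 1
    · refine Finset.sum_congr rfl fun A hA => ?_
      obtain ⟨h1, h2, h3, h4⟩ := mem_splits.mp hA
      rw [splitList_append_cons hPL.1 hPL.2, ← splitSign_eq hn (hsub h1 h2)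
        (hsub Finset.sdiff_subset (Finset.sdiff_nonempty.mpr fun h => h3 (h1.antisymm h))),
        consL_single, consL_single, Finsupp.lmapDomain_apply, Finsupp.mapDomain_single]
    · rw [LinearMap.comp_apply]
      simp only [Units.smul_def, Units.val_neg, neg_smul]

/-- The diagonal operator given by `listSign`. -/
noncomputable def signMap (K : Type u) [Field K] (V : Type w) [AddCommGroup V] [Module K V] :
    ListChain n V →ₗ[K] ListChain n V :=
  Finsupp.lsum K fun L => ((listSign L : ℤˣ) : ℤ) • Finsupp.lsingle L

theorem signMap_single (L : List (Finset (Fin n))) (v : V) :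
    signMap K V (Finsupp.single L v) = listSign L • Finsupp.single L v := by
  rw [signMap, Finsupp.lsum_single]
  rfl

theorem signMap_signMap (z : ListChain n V) : signMap K V (signMap K V z) = z := by
  induction z using Finsupp.induction_linear with
  | zero => simp
  | add x y hx hy => simp only [map_add, hx, hy]
  | single L v =>
    rw [signMap_single, Units.smul_def, map_zsmul, ← Units.smul_def, signMap_single, smul_smul,
      Int.units_mul_self, one_smul]

theorem signMap_mem_supported {s : Set (List (Finset (Fin n)))} {z : ListChain n V}
    (hz : z ∈ Finsupp.supported V K s) : signMap K V z ∈ Finsupp.supported V K s := by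
  refine map_mem_supported (fun L hL v => ?_) hz
  rw [signMap_single, Units.smul_def]
  exact zsmul_mem (Finsupp.single_mem_supported K v hL) _

/-- The boundary, with signs that do not depend on the order of the blocks. -/
noncomputable def signedBd (K : Type u) [Field K] (V : Type w) [AddCommGroup V] [Module K V]
    (X : Finpartition (Finset.univ : Finset (Fin n))) : ListChain n V →ₗ[K] ListChain n V :=
  signMap K V ∘ₗ bd K V X ∘ₗ signMap K V

theorem signedBd_signedBd (z : ListChain n V) : signedBd K V X (signedBd K V X z) = 0 := by
  simp only [signedBd, LinearMap.comp_apply, signMap_signMap, bd_bd, map_zero]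

/-- The coefficients now depend only on the set of blocks and on the splitting, so they are
unaffected when the monoid rearranges the blocks. -/
theorem signedBd_single {L : List (Finset (Fin n))} (hd : L.Pairwise Disjoint)
    (h0 : ∀ P ∈ L, P.Nonempty) (v : V) :
    signedBd K V X (Finsupp.single L v) = ∑ P ∈ L.toFinset, ∑ A ∈ splits X P,
      splitSign L.toFinset P A • Finsupp.single (splitList L P A) v := by
  have h := smul_bd_single (K := K) X [] L hd h0 v
  have e : Finsupp.lmapDomain V K (([] : List (Finset (Fin n))) ++ ·) = LinearMap.id :=
    Finsupp.lmapDomain_id V K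
  rw [e, List.length_nil, pow_zero, one_smul, LinearMap.id_apply, List.nil_append] at h
  rw [signedBd, LinearMap.comp_apply, LinearMap.comp_apply, signMap_single, Units.smul_def,
    map_zsmul, h, map_zsmul, map_sum, Finset.smul_sum]
  refine Finset.sum_congr rfl fun P _ => ?_
  rw [map_sum, Finset.smul_sum]
  refine Finset.sum_congr rfl fun A _ => ?_
  rw [Units.smul_def, map_zsmul, signMap_single, ← Units.smul_def, ← Units.smul_def, smul_smul,
    smul_smul]
  congr 1
  have e (a b c : ℤˣ) : a * (b * a * c) * b = c := by
    rw [show a * (b * a * c) * b = (a * a) * (b * b) * c by ac_rfl]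
    simp only [Int.units_mul_self, one_mul]
  exact e _ _ _

end Signs

open OrderedSetPartition

/-! ### Equivariance of the boundary and the augmentation -/

section Action

variable {n : ℕ} {X : Finpartition (Finset.univ : Finset (Fin n))}

/-- The fixed-point-free involution `A ↦ P \ A` preserves `f` and flips the sign. -/
theorem sum_splitSign_smul_eq_zero {M : Type*} [AddCommGroup M] (s : Finset (Finset (Fin n)))
    {P : Finset (Fin n)} (hP : Saturated X P) (f : Finset (Fin n) → M)
    (hf : ∀ A ∈ splits X P, f (P \ A) = f A) :
    ∑ A ∈ splits X P, splitSign s P A • f A = 0 := by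
  have hne {A} (hA : A ∈ splits X P) : A ≠ P \ A := fun h => by
    obtain ⟨h1, ⟨i, hi⟩, -⟩ := mem_splits.mp hA
    exact (Finset.mem_sdiff.mp (h ▸ hi : i ∈ P \ A)).2 hi
  refine Finset.sum_involution (fun A _ => P \ A) (fun A hA => ?_)
    (fun A hA _ => (hne hA).symm) (fun A hA => sdiff_mem_splits hP hA)
    (fun A hA => Finset.sdiff_sdiff_eq_self (mem_splits.mp hA).1)
  rw [splitSign_sdiff s (mem_splits.mp hA).1 (hne hA), hf A hA]
  simp only [Units.smul_def, Units.val_neg, neg_smul, add_neg_cancel]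

theorem mem_splitList {L : List (Finset (Fin n))} {P A Q : Finset (Fin n)} :
    Q ∈ splitList L P A ↔ (Q ∈ L ∧ Q ≠ P) ∨ (P ∈ L ∧ (Q = A ∨ Q = P \ A)) := by
  rw [splitList, List.mem_flatMap]
  constructor
  · rintro ⟨R, hR, hQ⟩
    split_ifs at hQ with h
    · subst h
      exact Or.inr ⟨hR, by simpa using hQ⟩
    · obtain rfl := List.mem_singleton.mp hQ
      exact Or.inl ⟨hR, h⟩
  · rintro (⟨hQ, h⟩ | ⟨hP, h⟩)
    · exact ⟨Q, hQ, by simp [h]⟩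
    · exact ⟨P, hP, by simpa using h⟩

/-- Every set of the list `L` is contained in a set of the list `N`. -/
def Refines (L N : List (Finset (Fin n))) : Prop := ∀ P ∈ L, ∃ M ∈ N, P ⊆ M

theorem le_iff_refines {π μ : OrderedSetPartition n} :
    π.toFinpartition ≤ μ.toFinpartition ↔ Refines π.blocks μ.blocks := by
  simp only [Refines, ← mem_toFinpartition]
  rfl

/-- Every intersection `M ∩ Q` is `Q` or empty, so the product only rearranges the members of `L`.
-/
theorem mulBlocks_of_refines {L N : List (Finset (Fin n))} (h : Refines L N)
    (hL : ∀ P ∈ L, P.Nonempty) (hN : N.Pairwise Disjoint) :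
    mulBlocks N L = N.flatMap fun M => L.flatMap fun Q => if Q ⊆ M then [Q] else [] := by
  have e : ∀ M : Finset (Fin n), (L.map fun Q => M ∩ Q).filter (fun P => P.Nonempty) =
      L.flatMap fun Q => if (M ∩ Q).Nonempty then [M ∩ Q] else [] := fun M => by
    clear h hL
    induction L with
    | nil => rfl
    | cons Q L ih =>
      rw [List.map_cons, List.filter_cons, ih, List.flatMap_cons]
      by_cases h : (M ∩ Q).Nonempty <;> simp [h]
  rw [mulBlocks, List.filter_flatMap]
  refine List.flatMap_congr fun M hM => ?_
  rw [e]
  refine List.flatMap_congr fun Q hQ => ?_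
  by_cases hQM : Q ⊆ M
  · rw [Finset.inter_eq_right.mpr hQM, if_pos hQM, if_pos (hL Q hQ)]
  · obtain ⟨M', hM', hQM'⟩ := h Q hQ
    have hMM' : M ≠ M' := fun e => hQM (e ▸ hQM')
    have hd : Disjoint M Q := (hN.forall hM hM' hMM').mono_right hQM'
    rw [if_neg hQM, if_neg]
    rw [Finset.disjoint_iff_inter_eq_empty.mp hd]
    exact Finset.not_nonempty_empty

theorem refines_splitList {L N : List (Finset (Fin n))} {P A : Finset (Fin n)} (hA : A ⊆ P)
    (h : Refines L N) : Refines (splitList L P A) N := by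
  intro Q hQ
  rcases mem_splitList.mp hQ with ⟨hQ, -⟩ | ⟨hP, rfl | rfl⟩
  · exact h Q hQ
  · obtain ⟨M, hM, hPM⟩ := h P hP
    exact ⟨M, hM, hA.trans hPM⟩
  · obtain ⟨M, hM, hPM⟩ := h P hP
    exact ⟨M, hM, Finset.sdiff_subset.trans hPM⟩

theorem nonempty_of_mem_splitList {L : List (Finset (Fin n))} {P A : Finset (Fin n)}
    (hA : A.Nonempty) (hA' : (P \ A).Nonempty) (hL : ∀ P ∈ L, P.Nonempty) :
    ∀ Q ∈ splitList L P A, Q.Nonempty := by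
  intro Q hQ
  rcases mem_splitList.mp hQ with ⟨hQ, -⟩ | ⟨hP, rfl | rfl⟩
  exacts [hL Q hQ, hA, hA']

/-- Both parts of `P` lie in the same member of `N` as `P`, so they stay adjacent and in order under
the rearrangement. -/
theorem mulBlocks_splitList {L N : List (Finset (Fin n))} {P A : Finset (Fin n)} (h : Refines L N)
    (hL : ∀ P ∈ L, P.Nonempty) (hN : N.Pairwise Disjoint) (hAP : A ⊆ P) (hA : A.Nonempty)
    (hA' : (P \ A).Nonempty) :
    mulBlocks N (splitList L P A) = splitList (mulBlocks N L) P A := by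
  rw [mulBlocks_of_refines (refines_splitList hAP h) (nonempty_of_mem_splitList hA hA' hL) hN,
    mulBlocks_of_refines h hL hN, splitList, splitList, List.flatMap_assoc]
  refine List.flatMap_congr fun M hM => ?_
  rw [List.flatMap_assoc, List.flatMap_assoc]
  refine List.flatMap_congr fun Q hQ => ?_
  by_cases hQP : Q = P
  · subst hQP
    by_cases hQM : Q ⊆ M
    · simp [hQM, hAP.trans hQM, Finset.sdiff_subset.trans hQM]
    · obtain ⟨M', hM', hQM'⟩ := h Q hQ
      have hMM' : M ≠ M' := fun e => hQM (e ▸ hQM')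
      have hd : Disjoint M Q := (hN.forall hM hM' hMM').mono_right hQM'
      have hns {B : Finset (Fin n)} (hB : B ⊆ Q) (hB0 : B.Nonempty) : ¬ B ⊆ M := fun hBM => by
        obtain ⟨i, hi⟩ := hB0
        exact Finset.disjoint_left.mp hd (hBM hi) (hB hi)
      simp [hQM, hns hAP hA, hns Finset.sdiff_subset hA']
  · by_cases hQM : Q ⊆ M <;> simp [hQP, hQM]

/-- The two parts of `P` cannot lie in the same member of `N`, so their order in the product is
dictated by `N` and not by the list. -/
theorem mulBlocks_splitList_sdiff {L N : List (Finset (Fin n))} {P A : Finset (Fin n)}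
    (h : Refines (splitList L P A) N) (hP : ¬ ∃ M ∈ N, P ⊆ M)
    (hL : ∀ P ∈ L, P.Nonempty) (hN : N.Pairwise Disjoint) (hAP : A ⊆ P) (hA : A.Nonempty)
    (hA' : (P \ A).Nonempty) :
    mulBlocks N (splitList L P (P \ A)) = mulBlocks N (splitList L P A) := by
  have hAA : P \ (P \ A) = A := Finset.sdiff_sdiff_eq_self hAP
  have h' : Refines (splitList L P (P \ A)) N := by
    intro Q hQ
    refine h Q ?_
    rw [mem_splitList, hAA] at hQ
    rw [mem_splitList]
    tauto
  rw [mulBlocks_of_refines h (nonempty_of_mem_splitList hA hA' hL) hN,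
    mulBlocks_of_refines h' (nonempty_of_mem_splitList hA' (hAA.symm ▸ hA) hL) hN]
  refine List.flatMap_congr fun M hM => ?_
  rw [splitList, splitList, List.flatMap_assoc, List.flatMap_assoc]
  refine List.flatMap_congr fun Q hQ => ?_
  by_cases hQP : Q = P
  · subst hQP
    rw [if_pos rfl, if_pos rfl, hAA]
    by_cases h1 : A ⊆ M
    · by_cases h2 : Q \ A ⊆ M
      · refine absurd ⟨M, hM, fun i hi => ?_⟩ hP
        by_cases hiA : i ∈ A
        · exact h1 hiA
        · exact h2 (Finset.mem_sdiff.mpr ⟨hi, hiA⟩)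
      · simp [h1, h2]
    · simp [h1]
  · rw [if_neg hQP, if_neg hQP]

variable {K : Type u} [Field K] {V : Type w} [AddCommGroup V] [Module K V]

open Classical in
/-- The action of an ordered set partition on the chains on lists, with a given action on the
coefficients. -/
noncomputable def actL (μ : OrderedSetPartition n) (T : V →ₗ[K] V) :
    ListChain n V →ₗ[K] ListChain n V :=
  Finsupp.lsum K fun L =>
    if Refines L μ.blocks then Finsupp.lsingle (mulBlocks μ.blocks L) ∘ₗ T else 0

theorem actL_single_of_refines {μ : OrderedSetPartition n} (T : V →ₗ[K] V)
    {L : List (Finset (Fin n))} (h : Refines L μ.blocks) (v : V) :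
    actL μ T (Finsupp.single L v) = Finsupp.single (mulBlocks μ.blocks L) (T v) := by
  rw [actL, Finsupp.lsum_single, if_pos h]
  rfl

theorem actL_single_of_not_refines {μ : OrderedSetPartition n} (T : V →ₗ[K] V)
    {L : List (Finset (Fin n))} (h : ¬ Refines L μ.blocks) (v : V) :
    actL μ T (Finsupp.single L v) = 0 := by
  rw [actL, Finsupp.lsum_single, if_neg h]
  rfl

theorem signedBd_actL_single (μ π : OrderedSetPartition n) (T : V →ₗ[K] V)
    (hX : ∀ P ∈ π.blocks, Saturated X P) (v : V) :
    signedBd K V X (actL μ T (Finsupp.single π.blocks v)) =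
      actL μ T (signedBd K V X (Finsupp.single π.blocks v)) := by
  rw [signedBd_single X π.disjoint π.nonempty, map_sum]
  have hsub {P A} (hA : A ∈ splits X P) : A ⊆ P ∧ A.Nonempty ∧ (P \ A).Nonempty :=
    ⟨(mem_splits.mp hA).1, (mem_splits.mp hA).2.1, Finset.sdiff_nonempty.mpr fun h =>
      (mem_splits.mp hA).2.2.1 ((mem_splits.mp hA).1.antisymm h)⟩
  by_cases h : Refines π.blocks μ.blocks
  · have e : (mulBlocks μ.blocks π.blocks).toFinset = π.blocks.toFinset :=
      congrArg Finpartition.parts (toFinpartition_mul_of_le (le_iff_refines.mpr h))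
    rw [actL_single_of_refines T h, ← blocks_mul, signedBd_single X (μ * π).disjoint
      (μ * π).nonempty, blocks_mul, e]
    refine Finset.sum_congr rfl fun P hP => ?_
    rw [map_sum]
    refine Finset.sum_congr rfl fun A hA => ?_
    obtain ⟨h1, h2, h3⟩ := hsub hA
    rw [Units.smul_def, Units.smul_def, map_zsmul,
      actL_single_of_refines T (refines_splitList h1 h),
      mulBlocks_splitList h π.nonempty μ.disjoint h1 h2 h3]
  -- Here `π` is killed, but some of its splittings may survive: those that split the only block
  -- `P₀` contained in no block of `μ`. They cancel in pairs, since exchanging the two parts keeps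
  -- the product and flips the sign.
  · rw [actL_single_of_not_refines T h, map_zero]
    obtain ⟨P₀, hP₀, hn⟩ : ∃ P ∈ π.blocks, ¬ ∃ M ∈ μ.blocks, P ⊆ M := by
      simpa only [Refines, not_forall, exists_prop] using h
    symm
    refine Finset.sum_eq_zero fun P hP => ?_
    rw [map_sum]
    simp only [Units.smul_def, map_zsmul]
    simp only [← Units.smul_def]
    refine sum_splitSign_smul_eq_zero _ (hX P (List.mem_toFinset.mp hP))
      (fun A => actL μ T (Finsupp.single (splitList π.blocks P A) v)) fun A hA => ?_
    obtain ⟨h1, h2, h3⟩ := hsub hA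
    have hiff : Refines (splitList π.blocks P (P \ A)) μ.blocks ↔
        Refines (splitList π.blocks P A) μ.blocks := by
      simp only [Refines, mem_splitList, Finset.sdiff_sdiff_eq_self h1,
        or_comm (b := _ = P \ A)]
    by_cases hs : Refines (splitList π.blocks P A) μ.blocks
    · have hPP : P = P₀ := by
        by_contra hne
        exact hn (hs P₀ (mem_splitList.mpr (Or.inl ⟨hP₀, Ne.symm hne⟩)))
      subst hPP
      rw [actL_single_of_refines T hs, actL_single_of_refines T (hiff.mpr hs),
        mulBlocks_splitList_sdiff hs hn π.nonempty μ.disjoint h1 h2 h3]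
    · rw [actL_single_of_not_refines T hs, actL_single_of_not_refines T (mt hiff.mp hs)]

/-- The sum of the coefficients of a chain. -/
noncomputable def augL (K : Type u) [Field K] (V : Type w) [AddCommGroup V] [Module K V] :
    ListChain n V →ₗ[K] V :=
  Finsupp.lsum K fun _ => LinearMap.id

theorem augL_single (L : List (Finset (Fin n))) (v : V) :
    augL K V (Finsupp.single L v) = v := by
  rw [augL, Finsupp.lsum_single, LinearMap.id_apply]

theorem augL_signedBd_single (π : OrderedSetPartition n) (hX : ∀ P ∈ π.blocks, Saturated X P)
    (v : V) : augL K V (signedBd K V X (Finsupp.single π.blocks v)) = 0 := by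
  rw [signedBd_single X π.disjoint π.nonempty, map_sum]
  refine Finset.sum_eq_zero fun P hP => ?_
  rw [map_sum]
  simp only [Units.smul_def, map_zsmul, augL_single]
  simp only [← Units.smul_def]
  exact sum_splitSign_smul_eq_zero _ (hX P (List.mem_toFinset.mp hP)) (fun _ => v) fun _ _ => rfl

end Action

open OrderedSetPartition

/-! ### The complex of ordered set partitions coarser than `X` -/

section Complex

variable {n : ℕ} (X : Finpartition (Finset.univ : Finset (Fin n)))

theorem OrderedSetPartition.nodup_blocks (π : OrderedSetPartition n) : π.blocks.Nodup :=
  π.disjoint.imp_of_mem fun {P Q} hP _ h e => by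
    obtain ⟨i, hi⟩ := π.nonempty P hP
    exact Finset.disjoint_left.mp h hi (e ▸ hi)

theorem OrderedSetPartition.card_toFinpartition (π : OrderedSetPartition n) :
    π.toFinpartition.parts.card = π.blocks.length :=
  List.toFinset_card_of_nodup (nodup_blocks π)

variable {X} in
-- Sending a block of `X` to the block of `Y` containing it is surjective, hence injective by the
-- count, so every block of `Y` is a single block of `X`.
theorem eq_of_le_of_card_le {Y : Finpartition (Finset.univ : Finset (Fin n))} (h : X ≤ Y)
    (hc : X.parts.card ≤ Y.parts.card) : X = Y := by
  choose F hF hBF using fun B hB => h (b := B) hB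
  have hFi {B C i} (hB : B ∈ X.parts) (hC : C ∈ Y.parts) (hi : i ∈ B) (hiC : i ∈ C) :
      F B hB = C :=
    Y.eq_of_mem_parts (hF B hB) hC (hBF B hB hi) hiC
  have hinj := Finset.inj_on_of_surj_on_of_card_le F hF (fun C hC => by
    obtain ⟨i, hi⟩ := Y.nonempty_of_mem_parts hC
    obtain ⟨B, hB, hiB⟩ := X.exists_mem (Finset.mem_univ i)
    exact ⟨B, hB, (hFi hB hC hiB hi)⟩) hc
  have hsub : X.parts ⊆ Y.parts := fun B hB => by
    have : B = F B hB := (hBF B hB).antisymm fun i hi => by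
      obtain ⟨B', hB', hi'⟩ := X.exists_mem (Finset.mem_univ i)
      rwa [hinj hB hB' (hFi hB' (hF B hB) hi' hi).symm]
    exact this ▸ hF B hB
  exact Finpartition.ext (Finset.eq_of_subset_of_card_le hsub (Finpartition.card_mono h))

variable {X} in
theorem isOrdering_blocks {π : OrderedSetPartition n} (h : X ≤ π.toFinpartition) :
    IsOrdering X X.parts π.blocks where
  nonempty := π.nonempty
  saturated P hP B hB i hiB hiP := by
    obtain ⟨Q, hQ, hBQ⟩ := h hB
    rwa [π.toFinpartition.eq_of_mem_parts (mem_toFinpartition.mpr hP) hQ hiP (hBQ hiB)]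
  disjoint := π.disjoint
  mem_iff B hB := iff_of_true hB (by
    obtain ⟨Q, hQ, hBQ⟩ := h hB
    exact ⟨Q, mem_toFinpartition.mp hQ, hBQ⟩)

variable {X} in
theorem IsOrdering.exists_blocks_eq {L : List (Finset (Fin n))} (h : IsOrdering X X.parts L) :
    ∃ π : OrderedSetPartition n, X ≤ π.toFinpartition ∧ π.blocks = L := by
  have hm : ∀ B ∈ X.parts, ∃ P ∈ L, B ⊆ P := fun B hB => (h.mem_iff B hB).mp hB
  refine ⟨⟨L, h.nonempty, h.disjoint, fun i => ?_⟩, fun B hB => ?_, rfl⟩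
  · obtain ⟨B, hB, hi⟩ := X.exists_mem (Finset.mem_univ i)
    obtain ⟨P, hP, hBP⟩ := hm B hB
    exact ⟨P, hP, hBP hi⟩
  · obtain ⟨P, hP, hBP⟩ := hm B hB
    exact ⟨P, mem_toFinpartition.mpr hP, hBP⟩

/-- `Y` is coarser than or equal to `X` and has `k` blocks less. -/
def CoarserBy (k : ℕ) (Y : Finpartition (Finset.univ : Finset (Fin n))) : Prop :=
  X ≤ Y ∧ Y.parts.card + k = X.parts.card

/-- The ordered set partitions whose underlying set partition is coarser than or equal to `X` and
has `k` blocks less. -/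
abbrev CoarserOrdering (k : ℕ) := {π : OrderedSetPartition n // CoarserBy X k π.toFinpartition}

theorem injective_blocks (k : ℕ) :
    Function.Injective fun π : CoarserOrdering X k => π.1.blocks :=
  fun _ _ h => Subtype.ext (OrderedSetPartition.ext h)

theorem range_blocks (k : ℕ) : Set.range (fun π : CoarserOrdering X k => π.1.blocks) =
    {L | IsOrdering X X.parts L ∧ L.length + k = X.parts.card} := by
  ext L
  constructor
  · rintro ⟨π, rfl⟩
    exact ⟨isOrdering_blocks π.2.1, by rw [← card_toFinpartition]; exact π.2.2⟩
  · rintro ⟨h, hk⟩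
    obtain ⟨π, hπ, rfl⟩ := h.exists_blocks_eq
    exact ⟨⟨π, hπ, by rwa [card_toFinpartition]⟩, rfl⟩

variable (K : Type u) [Field K] (V : Type w) [AddCommGroup V] [Module K V]

/-- Ordered set partitions as lists. -/
noncomputable def toListChain (k : ℕ) : (CoarserOrdering X k →₀ V) →ₗ[K] ListChain n V :=
  Finsupp.lmapDomain V K fun π => π.1.blocks

variable {X K V} {k : ℕ}

theorem toListChain_single (π : CoarserOrdering X k) (v : V) :
    toListChain X K V k (Finsupp.single π v) = Finsupp.single π.1.blocks v :=
  Finsupp.mapDomain_single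

theorem toListChain_injective : Function.Injective (toListChain X K V k) :=
  Finsupp.mapDomain_injective (injective_blocks X k)

theorem toListChain_mem (z : CoarserOrdering X k →₀ V) :
    toListChain X K V k z ∈ Finsupp.supported V K
      {L | IsOrdering X X.parts L ∧ L.length + k = X.parts.card} := by
  have hz : z ∈ Finsupp.supported V K Set.univ := by simp
  refine map_mem_supported (fun π _ v => ?_) hz
  rw [toListChain_single]
  refine Finsupp.single_mem_supported K v ?_
  rw [← range_blocks]
  exact ⟨π, rfl⟩

theorem exists_toListChain_eq {z : ListChain n V} (hz : z ∈ Finsupp.supported V K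
      {L | IsOrdering X X.parts L ∧ L.length + k = X.parts.card}) :
    ∃ w, toListChain X K V k w = z := by
  rw [← range_blocks] at hz
  exact ⟨_, Finsupp.mapDomain_comapDomain _ (injective_blocks X k) z hz⟩

theorem signedBd_toListChain_mem (z : CoarserOrdering X (k + 1) →₀ V) :
    signedBd K V X (toListChain X K V (k + 1) z) ∈ Finsupp.supported V K
      {L | IsOrdering X X.parts L ∧ L.length + k = X.parts.card} := by
  refine map_mem_supported (fun L hL v => ?_) (toListChain_mem z)
  have h : Finsupp.single L v ∈ orderingChains X K V X.parts L.length :=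
    Finsupp.single_mem_supported K v ⟨hL.1, rfl⟩
  refine Finsupp.supported_mono ?_
    (signMap_mem_supported (bd_mem_orderingChains (signMap_mem_supported h)))
  rintro M ⟨hM, hM'⟩
  exact ⟨hM, by rw [hM', ← hL.2]; ring⟩

variable (X K V k) in
/-- The differential on ordered set partitions coarser than or equal to `X`. -/
noncomputable def coarserBd : (CoarserOrdering X (k + 1) →₀ V) →ₗ[K] (CoarserOrdering X k →₀ V) :=
  Finsupp.lcomapDomain _ (injective_blocks X k) ∘ₗ signedBd K V X ∘ₗ toListChain X K V (k + 1)

/-- Restricting to the lists that come from ordered set partitions loses nothing, because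
`signedBd_toListChain_mem` puts the boundary among them. -/
theorem toListChain_coarserBd (z : CoarserOrdering X (k + 1) →₀ V) :
    toListChain X K V k (coarserBd X K V k z) =
      signedBd K V X (toListChain X K V (k + 1) z) := by
  have h := signedBd_toListChain_mem (K := K) z
  rw [coarserBd, LinearMap.comp_apply, LinearMap.comp_apply]
  generalize signedBd K V X (toListChain X K V (k + 1) z) = y at h
  obtain ⟨w, rfl⟩ := exists_toListChain_eq h
  exact congrArg _ (Finsupp.comapDomain_mapDomain _ (injective_blocks X k) w)

theorem coarserBd_coarserBd (z : CoarserOrdering X (k + 2) →₀ V) :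
    coarserBd X K V k (coarserBd X K V (k + 1) z) = 0 := by
  apply toListChain_injective (K := K)
  rw [toListChain_coarserBd, toListChain_coarserBd, signedBd_signedBd, map_zero]

theorem augL_toListChain_coarserBd (z : CoarserOrdering X 1 →₀ V) :
    augL K V (toListChain X K V 0 (coarserBd X K V 0 z)) = 0 := by
  rw [toListChain_coarserBd]
  induction z using Finsupp.induction_linear with
  | zero => simp
  | add x y hx hy => simp only [map_add, hx, hy, add_zero]
  | single π v =>
    rw [toListChain_single]
    exact augL_signedBd_single π.1 (isOrdering_blocks π.2.1).saturated v

theorem exists_eq_coarserBd_add_single : ∃ l : List (Finset (Fin n)), l.length = X.parts.card ∧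
    ∀ k, ∀ z : CoarserOrdering X k →₀ V, signedBd K V X (toListChain X K V k z) = 0 →
      ∃ y v, toListChain X K V k z =
        toListChain X K V k (coarserBd X K V k y) + Finsupp.single l v := by
  obtain ⟨l, hl, h⟩ := exists_eq_bd_add_single (X := X) (K := K) (V := V) X.parts le_rfl
  refine ⟨l, hl, fun k z hz => ?_⟩
  by_cases hk : k ≤ X.parts.card
  · have hmem : signMap K V (toListChain X K V k z) ∈
        orderingChains X K V X.parts (X.parts.card - k) := by
      refine Finsupp.supported_mono ?_ (signMap_mem_supported (toListChain_mem z))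
      exact fun L hL => ⟨hL.1, Nat.eq_sub_of_add_eq hL.2⟩
    have hbd : bd K V X (signMap K V (toListChain X K V k z)) = 0 := by
      rw [← signMap_signMap (K := K) (bd K V X _)]
      exact (congrArg (signMap K V) hz).trans (map_zero _)
    obtain ⟨y, hy, v, e⟩ := h _ _ hmem hbd
    have hy' : signMap K V y ∈ Finsupp.supported V K
        {L | IsOrdering X X.parts L ∧ L.length + (k + 1) = X.parts.card} := by
      refine Finsupp.supported_mono ?_ (signMap_mem_supported hy)
      rintro L ⟨h1, h2⟩
      exact ⟨h1, by omega⟩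
    obtain ⟨y', hy'⟩ := exists_toListChain_eq hy'
    refine ⟨y', listSign l • v, ?_⟩
    rw [toListChain_coarserBd, hy', signedBd, LinearMap.comp_apply, LinearMap.comp_apply,
      signMap_signMap, ← signMap_signMap (K := K) (toListChain X K V k z), e, map_add, signMap_single,
      Units.smul_def, Units.smul_def, Finsupp.smul_single]
  · have : toListChain X K V k z = 0 := by
      refine Finsupp.support_eq_empty.mp (Finset.eq_empty_of_forall_notMem fun L hL => ?_)
      have := (toListChain_mem (K := K) z hL).2
      omega
    exact ⟨0, 0, by simp [this]⟩

theorem exists_coarserBd_eq (z : CoarserOrdering X (k + 1) →₀ V) (hz : coarserBd X K V k z = 0) :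
    ∃ y, coarserBd X K V (k + 1) y = z := by
  obtain ⟨l, hl, h⟩ := exists_eq_coarserBd_add_single (X := X) (K := K) (V := V)
  obtain ⟨y, v, e⟩ := h _ z (by rw [← toListChain_coarserBd, hz, map_zero])
  -- In positive degree the lists are shorter than `l`; comparing coefficients at `l` forces `v =
  -- 0`.
  have h0 (w : CoarserOrdering X (k + 1) →₀ V) : toListChain X K V (k + 1) w l = 0 := by
    by_contra h
    have := (toListChain_mem (K := K) w (Finsupp.mem_support_iff.mpr h)).2
    omega
  refine ⟨y, toListChain_injective (K := K) ?_⟩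
  have hv := DFunLike.congr_fun e l
  rw [Finsupp.add_apply, h0, h0, zero_add, Finsupp.single_eq_same] at hv
  rw [e, ← hv, Finsupp.single_zero, add_zero]

theorem exists_coarserBd_zero_eq (z : CoarserOrdering X 0 →₀ V)
    (hz : augL K V (toListChain X K V 0 z) = 0) : ∃ y, coarserBd X K V 0 y = z := by
  obtain ⟨l, hl, h⟩ := exists_eq_coarserBd_add_single (X := X) (K := K) (V := V)
  -- An ordering has at most `X.parts.card` members, so in degree zero every chain is a cycle.
  have hbd : signedBd K V X (toListChain X K V 0 z) = 0 := by
    have hmem : signMap K V (toListChain X K V 0 z) ∈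
        orderingChains X K V X.parts X.parts.card :=
      signMap_mem_supported (toListChain_mem z)
    have : bd K V X (signMap K V (toListChain X K V 0 z)) = 0 := by
      refine Finsupp.support_eq_empty.mp (Finset.eq_empty_of_forall_notMem fun L hL => ?_)
      obtain ⟨h1, h2⟩ := bd_mem_orderingChains hmem hL
      obtain ⟨π, hπ, rfl⟩ := h1.exists_blocks_eq
      have := Finpartition.card_mono hπ
      rw [card_toFinpartition] at this
      omega
    rw [signedBd, LinearMap.comp_apply, LinearMap.comp_apply, this, map_zero]
  obtain ⟨y, v, e⟩ := h _ z hbd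
  refine ⟨y, toListChain_injective (K := K) ?_⟩
  -- The augmentation kills boundaries, so it reads off `v`.
  have hv := congrArg (augL K V) e
  rw [hz, map_add, augL_toListChain_coarserBd, augL_single, zero_add] at hv
  rw [e, ← hv, Finsupp.single_zero, add_zero]

variable {G : Type v} [Group G] (ρ : Representation K (blockSubgroup G X) V)

variable (k) in
/-- The terms of the projective resolution of the inflation of `ρ`. -/
noncomputable def coarserRep :
    Representation K (GPartitionMonoid n G) (CoarserOrdering X k →₀ V) :=
  chainRep ρ fun _ h => h.1

theorem toListChain_coarserRep (m : GPartitionMonoid n G) (z : CoarserOrdering X k →₀ V) :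
    toListChain X K V k (coarserRep k ρ m z) =
      actL m.1.1 (inflateRep X ρ m) (toListChain X K V k z) := by
  induction z using Finsupp.induction_linear with
  | zero => simp
  | add x y hx hy => simp only [map_add, hx, hy]
  | single π v =>
    rw [toListChain_single, coarserRep, chainRep_apply]
    by_cases h : π.1.toFinpartition ≤ supp m
    · have hX : X ≤ supp m := π.2.1.trans h
      let g : blockSubgroup G X := ⟨m.1.2, blockSubgroup_anti hX (snd_mem_blockSubgroup m)⟩
      let π' : CoarserOrdering X k :=
        ⟨m.1.1 * π.1, (toFinpartition_mul_of_le h).symm ▸ π.2⟩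
      rw [chainMap_single_of_le ρ _ (m := m) (π := π) (π' := π') h rfl (g := g) rfl,
        toListChain_single, actL_single_of_refines _ (le_iff_refines.mp h),
        inflateRep_of_le hX (g := g) rfl]
      rfl
    · rw [chainMap_single_of_not_le ρ _ h, map_zero,
        actL_single_of_not_refines _ (mt le_iff_refines.mpr h)]

theorem signedBd_actL (m : GPartitionMonoid n G) (z : CoarserOrdering X k →₀ V) :
    signedBd K V X (actL m.1.1 (inflateRep X ρ m) (toListChain X K V k z)) =
      actL m.1.1 (inflateRep X ρ m) (signedBd K V X (toListChain X K V k z)) := by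
  induction z using Finsupp.induction_linear with
  | zero => simp
  | add x y hx hy => simp only [map_add, hx, hy]
  | single π v =>
    rw [toListChain_single]
    exact signedBd_actL_single _ π.1 _ (isOrdering_blocks π.2.1).saturated v

variable (k) in
/-- The differential of the projective resolution of the inflation of `ρ`. -/
noncomputable def coarserBdMap :
    Representation.IntertwiningMap (coarserRep (k + 1) ρ) (coarserRep k ρ) where
  toLinearMap := coarserBd X K V k
  isIntertwining' m := by
    refine LinearMap.ext fun z => toListChain_injective (K := K) ?_
    rw [LinearMap.comp_apply, LinearMap.comp_apply, toListChain_coarserBd, toListChain_coarserRep,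
      toListChain_coarserRep, toListChain_coarserBd, signedBd_actL]

/-- The augmentation of the projective resolution of the inflation of `ρ`. -/
noncomputable def coarserAug :
    Representation.IntertwiningMap (coarserRep 0 ρ) (inflateRep X ρ) where
  toLinearMap := augL K V ∘ₗ toListChain X K V 0
  isIntertwining' m := by
    refine Finsupp.lhom_ext fun π v => ?_
    rw [LinearMap.comp_apply, LinearMap.comp_apply, LinearMap.comp_apply, LinearMap.comp_apply,
      toListChain_coarserRep, toListChain_single, augL_single]
    -- In degree zero `π` is an ordering of `X`, so `m` kills the chain exactly when it is required
    -- to act as `0` on the coefficients.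
    have hπ : π.1.toFinpartition = X := (eq_of_le_of_card_le π.2.1 π.2.2.ge).symm
    by_cases h : Refines π.1.blocks m.1.1.blocks
    · rw [actL_single_of_refines _ h, augL_single]
    · rw [actL_single_of_not_refines _ h, map_zero, inflateRep_of_not_le]
      · rfl
      · rw [← hπ]
        exact mt le_iff_refines.mp h

theorem coarserAug_surjective : Function.Surjective (coarserAug ρ) := fun v =>
  ⟨Finsupp.single ⟨ordering X, by rw [toFinpartition_ordering]; exact ⟨le_rfl, rfl⟩⟩ v,
    (congrArg (augL K V) (toListChain_single _ v)).trans (augL_single _ v)⟩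

end Complex

open CategoryTheory

/-! ### Breaking a resolution into short exact sequences -/

section Syzygies

variable {R : Type u} [Ring R] {C : ℕ → Type v} [∀ k, AddCommGroup (C k)] [∀ k, Module R (C k)]
  (d : ∀ k, C (k + 1) →ₗ[R] C k) {N : Type v} [AddCommGroup N] [Module R N] (ε : C 0 →ₗ[R] N)

/-- The short exact sequences into which an augmented exact sequence breaks up. -/
noncomputable def syzygyComplex : ℕ → ShortComplex (ModuleCat.{v} R)
  | 0 => ε.shortComplexKer
  | k + 1 => (d k).rangeRestrict.shortComplexKer

theorem shortExact_syzygyComplex (hε : Function.Surjective ε) (k : ℕ) :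
    (syzygyComplex d ε k).ShortExact := by
  cases k with
  | zero => exact LinearMap.shortExact_shortComplexKer hε
  | succ k => exact LinearMap.shortExact_shortComplexKer (d k).surjective_rangeRestrict

theorem syzygyComplex_X₁ (h : LinearMap.range (d 0) = LinearMap.ker ε)
    (hd : ∀ k, LinearMap.range (d (k + 1)) = LinearMap.ker (d k)) (k : ℕ) :
    (syzygyComplex d ε k).X₁ = (syzygyComplex d ε (k + 1)).X₃ := by
  cases k with
  | zero => exact congrArg (fun N : Submodule R (C 0) => ModuleCat.of R N) h.symm
  | succ k =>
    exact congrArg (fun N : Submodule R (C (k + 1)) => ModuleCat.of R N)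
      ((LinearMap.ker_rangeRestrict _).trans (hd k).symm)

theorem syzygyComplex_X₂ (k : ℕ) : (syzygyComplex d ε k).X₂ = ModuleCat.of R (C k) := by
  cases k <;> rfl

end Syzygies

/-! ### The projective resolution of an inflated representation -/

section Resolution

variable {n : ℕ} {X : Finpartition (Finset.univ : Finset (Fin n))} {K : Type u} [Field K]
  {G : Type v} [Group G] {V : Type (max u v)} [AddCommGroup V] [Module K V]
  (ρ : Representation K (blockSubgroup G X) V)

/-- The differential of the resolution as a linear map over the monoid algebra. -/
noncomputable def coarserBdLinear (k : ℕ) :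
    (coarserRep (k + 1) ρ).asModule →ₗ[K[GPartitionMonoid n G]] (coarserRep k ρ).asModule :=
  Representation.IntertwiningMap.equivLinearMapAsModule _ _ (coarserBdMap k ρ)

/-- The augmentation of the resolution as a linear map over the monoid algebra. -/
noncomputable def coarserAugLinear :
    (coarserRep 0 ρ).asModule →ₗ[K[GPartitionMonoid n G]] (inflateRep X ρ).asModule :=
  Representation.IntertwiningMap.equivLinearMapAsModule _ _ (coarserAug ρ)

theorem range_coarserBdLinear_zero :
    LinearMap.range (coarserBdLinear ρ 0) = LinearMap.ker (coarserAugLinear ρ) := by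
  ext z
  constructor
  · rintro ⟨y, rfl⟩
    exact augL_toListChain_coarserBd (K := K) (V := V) (X := X) y
  · exact fun h => exists_coarserBd_zero_eq (K := K) (V := V) (X := X) z h

theorem range_coarserBdLinear_succ (k : ℕ) :
    LinearMap.range (coarserBdLinear ρ (k + 1)) = LinearMap.ker (coarserBdLinear ρ k) := by
  ext z
  constructor
  · rintro ⟨y, rfl⟩
    exact coarserBd_coarserBd (K := K) (V := V) (X := X) y
  · exact fun h => exists_coarserBd_eq (K := K) (V := V) (X := X) z h

/-- The short exact sequences into which the resolution of the inflation of `ρ` breaks up. -/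
noncomputable def resolution : ℕ → ShortComplex (ModuleCat.{max u v} K[GPartitionMonoid n G]) :=
  syzygyComplex (C := fun k => (coarserRep k ρ).asModule) (coarserBdLinear ρ)
    (coarserAugLinear ρ)

theorem shortExact_resolution (k : ℕ) : (resolution ρ k).ShortExact :=
  shortExact_syzygyComplex (C := fun k => (coarserRep k ρ).asModule) (coarserBdLinear ρ)
    (coarserAugLinear ρ) (coarserAug_surjective ρ) k

theorem resolution_X₁ (k : ℕ) : (resolution ρ k).X₁ = (resolution ρ (k + 1)).X₃ :=
  syzygyComplex_X₁ (C := fun k => (coarserRep k ρ).asModule) (coarserBdLinear ρ)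
    (coarserAugLinear ρ) (range_coarserBdLinear_zero ρ) (range_coarserBdLinear_succ ρ) k

theorem resolution_X₂ (k : ℕ) : (resolution ρ k).X₂ =
    ModuleCat.of K[GPartitionMonoid n G] (coarserRep k ρ).asModule :=
  syzygyComplex_X₂ (C := fun k => (coarserRep k ρ).asModule) (coarserBdLinear ρ)
    (coarserAugLinear ρ) k

theorem projective_resolution_X₂ [Finite G] (hG : (Nat.card G : K) ≠ 0) (k : ℕ) :
    Projective (resolution ρ k).X₂ := by
  classical
  have := fun Y : Finpartition (Finset.univ : Finset (Fin n)) =>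
    Fintype.ofFinite (blockSubgroup G Y)
  rw [resolution_X₂]
  refine (IsProjective.iff_projective _).mp (projective_chainRep ρ _ fun Y hY => ?_)
  -- The order of `G_Y` divides `|G| ^ n`, so it is invertible in `K`.
  have h1 : Nat.card (blockSubgroup G Y) ∣ Nat.card G ^ n := by
    have := Subgroup.card_subgroup_dvd_card (blockSubgroup G Y)
    rwa [Nat.card_fun, Nat.card_eq_fintype_card (α := Fin n), Fintype.card_fin] at this
  obtain ⟨c, hc⟩ := h1
  rw [← Nat.card_eq_fintype_card] at hY
  refine pow_ne_zero n hG ?_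
  rw [← Nat.cast_pow, hc, Nat.cast_mul, hY, zero_mul]

end Resolution

/-- Homomorphisms between modules of representations are intertwining maps. -/
noncomputable def homEquivIntertwiningMap {K : Type u} [Field K] {M : Type v} [Monoid M]
    {U W : Type w} [AddCommGroup U] [Module K U] [AddCommGroup W] [Module K W]
    (τ : Representation K M U) (σ : Representation K M W) :
    letI := Linear.homModule (R := K) (ModuleCat.of K[M] τ.asModule) (ModuleCat.of K[M] σ.asModule)
    (ModuleCat.of K[M] τ.asModule ⟶ ModuleCat.of K[M] σ.asModule) ≃ₗ[K]
      Representation.IntertwiningMap τ σ :=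
  letI := Linear.homModule (R := K) (ModuleCat.of K[M] τ.asModule) (ModuleCat.of K[M] σ.asModule)
  { toFun φ := (Representation.IntertwiningMap.equivLinearMapAsModule τ σ).symm φ.hom
    invFun f := ModuleCat.ofHom (Representation.IntertwiningMap.equivLinearMapAsModule τ σ f)
    left_inv φ := ModuleCat.hom_ext (LinearEquiv.apply_symm_apply _ φ.hom)
    right_inv f := LinearEquiv.symm_apply_apply _ f
    map_add' φ ψ := by
      rw [ModuleCat.hom_add, map_add]
    map_smul' a φ := by
      rw [RingHom.id_apply, ← map_smul]
      congr 1
      refine LinearMap.ext fun x => ?_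
      exact algebraMap_smul K[M] a (φ.hom x) }

end Hsiao

/-! ### The `Ext` groups -/

theorem theoremt {K : Type u} [Field K] {G : Type v} [Group G] [Finite G]
    (hsplit : Hsiao.IsSplittingFieldFor K G) (hchar : ¬ ringChar K ∣ Nat.card G) (n : ℕ)
    (X Y : Finpartition (Finset.univ : Finset (Fin n)))
    {V : {P // P ∈ X.parts} → Type (max u v)} [∀ P, AddCommGroup (V P)] [∀ P, Module K (V P)]
    (f : ∀ P, Representation K G (V P)) (hf : ∀ P, (f P).IsIrreducible)
    {W : {P // P ∈ Y.parts} → Type (max u v)} [∀ P, AddCommGroup (W P)] [∀ P, Module K (W P)]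
    (h : ∀ P, Representation K G (W P)) (hh : ∀ P, (h P).IsIrreducible) (q : ℕ) :
    (¬ (X ≤ Y ∧ (q : ℤ) = (X.parts.card : ℤ) - (Y.parts.card : ℤ)) →
      Subsingleton
        (CategoryTheory.Abelian.Ext (Hsiao.simpleMod X f) (Hsiao.simpleMod Y h) q)) ∧
    (X ≤ Y ∧ (q : ℤ) = (X.parts.card : ℤ) - (Y.parts.card : ℤ) →
      Nonempty
        (CategoryTheory.Abelian.Ext (Hsiao.simpleMod X f) (Hsiao.simpleMod Y h) q ≃ₗ[K]
          ⨂[K] P : {P // P ∈ Y.parts},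
            Representation.IntertwiningMap
              (Hsiao.tensorRep fun Q : {Q : {Q // Q ∈ X.parts} // Q.1 ⊆ P.1} => f Q.1)
              (h P))) := by
  have hG : (Nat.card G : K) ≠ 0 := fun h0 => hchar (ringChar.dvd h0)
  have := fun P => (hf P).finite
  have := fun P => (hh P).finite
  let S := Hsiao.resolution (Hsiao.outerTensorRep X f)
  have hS := Hsiao.shortExact_resolution (Hsiao.outerTensorRep X f)
  have hproj := Hsiao.projective_resolution_X₂ (Hsiao.outerTensorRep X f) hG
  have e := Hsiao.resolution_X₁ (Hsiao.outerTensorRep X f)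
  have hsub (k : ℕ) (hk : ¬ Hsiao.CoarserBy X k Y) :
      Subsingleton ((S k).X₂ ⟶ Hsiao.simpleMod Y h) := by
    have h1 : Subsingleton (Representation.IntertwiningMap
        (Hsiao.coarserRep k (Hsiao.outerTensorRep X f))
        (Hsiao.inflateRep Y (Hsiao.outerTensorRep Y h))) :=
      Hsiao.subsingleton_intertwiningMap_chainRep (Hsiao.outerTensorRep X f) (fun _ h => h.1)
        (Hsiao.outerTensorRep Y h) hk
    have h2 := Hsiao.homEquivIntertwiningMap (Hsiao.coarserRep k (Hsiao.outerTensorRep X f))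
      (Hsiao.inflateRep Y (Hsiao.outerTensorRep Y h))
    rw [Hsiao.resolution_X₂]
    exact h2.toEquiv.subsingleton
  by_cases hXY : X ≤ Y
  · have hle := Finpartition.card_mono hXY
    -- The only degree whose term can have non-zero morphisms to `(Y, h)`; by `hle` the subtraction
    -- is not truncated.
    obtain ⟨h1, ⟨h2⟩⟩ := CategoryTheory.Abelian.Ext.of_resolution (Hsiao.simpleMod Y h) K
      (X.parts.card - Y.parts.card) S hS hproj e fun k hk => hsub k fun hk' => hk (by
        have := hk'.2
        omega)
    refine ⟨fun hq => h1 q fun hq' => hq ⟨hXY, by omega⟩, fun ⟨_, hq⟩ => ?_⟩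
    obtain rfl : q = X.parts.card - Y.parts.card := by omega
    obtain ⟨h3⟩ := Hsiao.nonempty_intertwiningMap_outerTensorRep hG hXY f h
    have h4 := Hsiao.chainRepHomEquiv (Hsiao.outerTensorRep X f) (fun _ h => h.1)
      (Hsiao.outerTensorRep Y h)
      (show Hsiao.CoarserBy X (X.parts.card - Y.parts.card) Y from ⟨hXY, by omega⟩)
    have h5 := Hsiao.homEquivIntertwiningMap (Hsiao.coarserRep (X.parts.card - Y.parts.card)
      (Hsiao.outerTensorRep X f)) (Hsiao.inflateRep Y (Hsiao.outerTensorRep Y h))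
    have h6 := CategoryTheory.Linear.homCongr K (CategoryTheory.eqToIso (Hsiao.resolution_X₂
      (Hsiao.outerTensorRep X f) (X.parts.card - Y.parts.card))) (CategoryTheory.Iso.refl (Hsiao.simpleMod Y h))
    exact ⟨h2 ≪≫ₗ h6 ≪≫ₗ h5 ≪≫ₗ h4 ≪≫ₗ h3⟩
  · refine ⟨fun _ => ?_, fun hq => absurd hq.1 hXY⟩
    -- If `Y` is not above `X`, no term of the resolution has a non-zero morphism to `(Y, h)`.
    exact CategoryTheory.Abelian.Ext.subsingleton_of_resolution S (Hsiao.simpleMod Y h) hS hproj e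
      (fun k => hsub k fun hk => hXY hk.1) q 0
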